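/- Let $(M,g_{ab})$ be a time-oriented four-dimensional smooth space-time of signature $(+,-,-,-)$ with Levi-Civita connection $\nabla_a$. Let $\mathcal H\subset M$ be a non-expanding horizon: an embedded null hypersurface homeomorphic to $\mathbb R\times S^2$ such that (i) every null normal $l^a$ of $\mathcal H$ has vanishing expansion $q^{ab}\nabla_a l_b$, where $q^{ab}=-m^a\bar m^b-\bar m^a m^b$ for any null tetrad $(l,n,m,\bar m)$ (i.e. $l_an^a=1$, $m_a\bar m^a=-1$, all other products zero); (ii) Einstein's equations $R_{ab}-\tfrac12 Rg_{ab}=8\pi T_{ab}$ hold on $\mathcal H$; (iii) for every future-pointing null normal $l^a$ the vector $T^a{}_b\,l^b$ is future pointing (causal, possibly zero). For $X^a$ tangent to $\mathcal H$ and a vector field $Y^a$ along $\mathcal H$ put $X^a\mathcal D_aY^b=X^a\nabla_aY^b$, computed with any smooth extension of $Y^b$ off $\mathcal H$ (the result does not depend on the extension). Let $\doteq$ denote equality on $\mathcal H$, and let $l^a$ be a smooth nowhere vanishing null normal of $\mathcal H$. Then there is a smooth real 1-form $\omega_a$ along $\mathcal H$ (a field of covectors of $M$ at the points of $\mathcal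 H$) such that $$X^a\mathcal D_a l^b\doteq (X^a\omega_a)\, l^b\qquad\text{for all } X^a \text{ tangent to } \mathcal H .$$ Moreover, let $v$ be a smooth function on $\mathcal H$ with $l^a\nabla_a v\doteq1$. Then $\omega_a$ can be chosen such that, in addition, for every smooth null tetrad $(l^a,n^a,m^a,\bar m^a)$ on an open part of $\mathcal H$ which contains the given $l^a$ and is adapted to the horizon, i.e. $m^a$ is tangent to the cuts $v=\mathrm{const}$ and Lie dragged along $l^a$, $l^b\nabla_bm^a-m^b\nabla_bl^a\doteq0$, one has there $$\omega_a\doteq(\epsilon+\bar\epsilon)\,n_a-\pi\,m_a-\bar\pi\,\bar m_a ,$$ where, with $D=l^a\nabla_a$, $\epsilon=\tfrac12\left(n_aDl^a-\bar m_aDm^a\right)$ and $\pi=-\bar m_aDn^a$. -/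

import Mathlib

open scoped Manifold ContDiff Topology Bundle

noncomputable section

namespace Horizon

/-! ### Space-times -/

/-- The model space of a four-dimensional manifold. -/
abbrev E4 : Type := EuclideanSpace ℝ (Fin 4)

/-- The entries of `diag(1, -1, -1, -1)` on the diagonal. -/
def sgn (i : Fin 4) : ℝ := if i = 0 then 1 else -1

section Manifold

variable (M : Type*) [TopologicalSpace M] [ChartedSpace E4 M] [IsManifold (𝓡 4) ∞ M]

/-- A smooth Lorentzian metric of signature `(+,-,-,-)` on a 4-manifold. -/
structure LorentzMetric where
  val (x : M) : TangentSpace (𝓡 4) x →L[ℝ] TangentSpace (𝓡 4) x →L[ℝ] ℝ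
  symm (x : M) (u w : TangentSpace (𝓡 4) x) : val x u w = val x w u
  signature (x : M) : ∃ e : Fin 4 → TangentSpace (𝓡 4) x,
    ∀ i j, val x (e i) (e j) = if i = j then sgn i else 0
  smooth : ContMDiff (𝓡 4) ((𝓡 4).prod 𝓘(ℝ, E4 →L[ℝ] E4 →L[ℝ] ℝ)) ∞
    (fun x ↦ Bundle.TotalSpace.mk' (E4 →L[ℝ] E4 →L[ℝ] ℝ)
      (E := fun x : M ↦ TangentSpace (𝓡 4) x →L[ℝ] TangentSpace (𝓡 4) x →L[ℝ] ℝ) x (val x))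

variable {M}

/-- A time orientation: a smooth vector field which is timelike everywhere; it is declared to be
future pointing. -/
structure TimeOrientation (g : LorentzMetric M) where
  field (x : M) : TangentSpace (𝓡 4) x
  timelike (x : M) : 0 < g.val x (field x) (field x)
  smooth : ContMDiff (𝓡 4) ((𝓡 4).prod 𝓘(ℝ, E4)) ∞
    (fun x ↦ Bundle.TotalSpace.mk' E4 (E := fun x : M ↦ TangentSpace (𝓡 4) x) x (field x))

/-- `V` is future pointing and causal, or zero.
(A nonzero causal vector is never orthogonal to a timelike one.) -/
def FutureCausal {g : LorentzMetric M} (t : TimeOrientation g) (x : M)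
    (V : TangentSpace (𝓡 4) x) : Prop :=
  0 ≤ g.val x V V ∧ 0 ≤ g.val x V (t.field x)

/-- A covariant derivative on the tangent bundle (in Mathlib's sense: `cov Y x X` is `∇_X Y` at
`x`). -/
abbrev Connection (M : Type*) [TopologicalSpace M] [ChartedSpace E4 M]
    [IsManifold (𝓡 4) ∞ M] : Type _ :=
  CovariantDerivative (𝓡 4) E4 (fun x : M ↦ TangentSpace (𝓡 4) x)

/-- `cov` is the Levi-Civita connection of `g`: it is smooth, metric and torsion free. -/
structure IsLeviCivita (g : LorentzMetric M) (cov : Connection M) : Prop where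
  smooth : cov.ContMDiffCovariantDerivative ∞
  torsion_free : cov.torsion = 0
  metric (x : M) (Y Z : Π x : M, TangentSpace (𝓡 4) x) (X : TangentSpace (𝓡 4) x) :
    MDifferentiableAt (𝓡 4) ((𝓡 4).prod 𝓘(ℝ, E4)) (fun y ↦ Bundle.TotalSpace.mk' E4 y (Y y)) x →
    MDifferentiableAt (𝓡 4) ((𝓡 4).prod 𝓘(ℝ, E4)) (fun y ↦ Bundle.TotalSpace.mk' E4 y (Z y)) x →
    mvfderiv (𝓡 4) (fun y ↦ g.val y (Y y) (Z y)) x X =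
      g.val x (cov Y x X) (Z x) + g.val x (Y x) (cov Z x X)

/-! ### Curvature and Einstein's equations -/

/-- `R(X,Y)Z = ∇_X ∇_Y Z - ∇_Y ∇_X Z - ∇_[X,Y] Z` for vector fields. -/
def riemannFields (cov : Connection M) (X Y Z : Π x : M, TangentSpace (𝓡 4) x) (x : M) :
    TangentSpace (𝓡 4) x :=
  cov (fun y ↦ cov Z y (Y y)) x (X x) - cov (fun y ↦ cov Z y (X y)) x (Y x)
    - cov Z x (VectorField.mlieBracket (𝓡 4) X Y x)

/-- The Riemann tensor `R(u,v)w` at a point, evaluated on extensions of the three vectors to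
vector fields that are smooth near the point. -/
def riemann (cov : Connection M) (x : M) (u v w : TangentSpace (𝓡 4) x) :
    TangentSpace (𝓡 4) x :=
  riemannFields cov (FiberBundle.extend E4 u) (FiberBundle.extend E4 v)
    (FiberBundle.extend E4 w) x

/-- An orthonormal frame of the tangent space at `x`. -/
def LorentzMetric.frame (g : LorentzMetric M) (x : M) : Fin 4 → TangentSpace (𝓡 4) x :=
  (g.signature x).choose

/-- `Ric(v,w)` is the trace of `u ↦ R(u,v)w`. -/
def ricci (g : LorentzMetric M) (cov : Connection M) (x : M) (v w : TangentSpace (𝓡 4) x) : ℝ :=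
  ∑ i, sgn i * g.val x (riemann cov x (g.frame x i) v w) (g.frame x i)

/-- The scalar curvature. -/
def scalarCurvature (g : LorentzMetric M) (cov : Connection M) (x : M) : ℝ :=
  ∑ i, sgn i * ricci g cov x (g.frame x i) (g.frame x i)

/-- Einstein's equations `Ric - R g / 2 = 8 π T` at the point `x` (units `G = c = 1`). -/
def EinsteinAt (g : LorentzMetric M) (cov : Connection M)
    (T : Π x : M, TangentSpace (𝓡 4) x →L[ℝ] TangentSpace (𝓡 4) x →L[ℝ] ℝ) (x : M) : Prop :=
  ∀ u w, ricci g cov x u w - scalarCurvature g cov x / 2 * g.val x u w = 8 * Real.pi * T x u w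

/-! ### Hypersurfaces and fields along them -/

/-- `S` is a smooth embedded hypersurface: locally the zero set of a smooth function with nowhere
vanishing differential. -/
def IsHypersurface (S : Set M) : Prop :=
  ∀ p ∈ S, ∃ (U : Set M) (u : M → ℝ), IsOpen U ∧ p ∈ U ∧ ContMDiffOn (𝓡 4) 𝓘(ℝ, ℝ) ∞ u U ∧
    (∀ x ∈ U, mvfderiv (𝓡 4) u x ≠ 0) ∧ S ∩ U = {x ∈ U | u x = 0}

/-- The tangent space of `S` at `p`: the vectors that annihilate every smooth function defined near
`p` and vanishing on `S`. -/
def tangentTo (S : Set M) (p : M) : Submodule ℝ (TangentSpace (𝓡 4) p) where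
  carrier := {X | ∀ (U : Set M) (f : M → ℝ), IsOpen U → p ∈ U →
    ContMDiffOn (𝓡 4) 𝓘(ℝ, ℝ) ∞ f U → (∀ x ∈ S ∩ U, f x = 0) → mvfderiv (𝓡 4) f p X = 0}
  add_mem' hX hY U f h₁ h₂ h₃ h₄ := by
    rw [map_add, hX U f h₁ h₂ h₃ h₄, hY U f h₁ h₂ h₃ h₄, add_zero]
  zero_mem' U f _ _ _ _ := map_zero _
  smul_mem' c X hX U f h₁ h₂ h₃ h₄ := by
    rw [map_smul, hX U f h₁ h₂ h₃ h₄, smul_zero]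

/-- The function `F` is smooth on a neighbourhood of `p` and equals `f` on `S` there. -/
def IsFunExtensionAt (S : Set M) (f : M → ℝ) (p : M) (F : M → ℝ) : Prop :=
  ∃ U : Set M, IsOpen U ∧ p ∈ U ∧ ContMDiffOn (𝓡 4) 𝓘(ℝ, ℝ) ∞ F U ∧ ∀ x ∈ S ∩ U, F x = f x

/-- The vector field `Z` is smooth on a neighbourhood of `p` and equals `Y` on `S` there. -/
def IsVecExtensionAt (S : Set M) (Y : Π x : M, TangentSpace (𝓡 4) x) (p : M)
    (Z : Π x : M, TangentSpace (𝓡 4) x) : Prop :=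
  ∃ U : Set M, IsOpen U ∧ p ∈ U ∧
    ContMDiffOn (𝓡 4) ((𝓡 4).prod 𝓘(ℝ, E4)) ∞ (fun x ↦ Bundle.TotalSpace.mk' E4 x (Z x)) U ∧
    ∀ x ∈ S ∩ U, Z x = Y x

/-- The 1-form `β` is smooth on a neighbourhood of `p` and equals `α` on `S` there. -/
def IsFormExtensionAt (S : Set M) (α : Π x : M, TangentSpace (𝓡 4) x →L[ℝ] ℝ) (p : M)
    (β : Π x : M, TangentSpace (𝓡 4) x →L[ℝ] ℝ) : Prop :=
  ∃ U : Set M, IsOpen U ∧ p ∈ U ∧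
    ContMDiffOn (𝓡 4) ((𝓡 4).prod 𝓘(ℝ, E4 →L[ℝ] ℝ)) ∞
      (fun x ↦ Bundle.TotalSpace.mk' (E4 →L[ℝ] ℝ)
        (E := fun x : M ↦ TangentSpace (𝓡 4) x →L[ℝ] ℝ) x (β x)) U ∧
    ∀ x ∈ S ∩ U, β x = α x

/-- `f` is a smooth function on `S` (its values off `S` are irrelevant). -/
def SmoothFunOn (S : Set M) (f : M → ℝ) : Prop := ∀ p ∈ S, ∃ F, IsFunExtensionAt S f p F

/-- `Y` is a smooth field along `S` of vectors of the space-time (its values off `S` are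
irrelevant). -/
def SmoothVecOn (S : Set M) (Y : Π x : M, TangentSpace (𝓡 4) x) : Prop :=
  ∀ p ∈ S, ∃ Z, IsVecExtensionAt S Y p Z

/-- `α` is a smooth field along `S` of covectors of the space-time (its values off `S` are
irrelevant). -/
def SmoothFormOn (S : Set M) (α : Π x : M, TangentSpace (𝓡 4) x →L[ℝ] ℝ) : Prop :=
  ∀ p ∈ S, ∃ β, IsFormExtensionAt S α p β

open Classical in
/-- The derivative at `p ∈ S` of a function on `S` in directions tangent to `S`, computed with any
smooth extension (see `diffOn_eq`). -/
def diffOn (S : Set M) (f : M → ℝ) (p : M) : TangentSpace (𝓡 4) p →L[ℝ] ℝ :=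
  if h : ∃ F, IsFunExtensionAt S f p F then mvfderiv (𝓡 4) h.choose p else 0

open Classical in
/-- The induced covariant derivative: for `p ∈ S` and `X` tangent to `S` at `p`,
`inducedDeriv cov S Y p X` is `𝒟_X Y = ∇_X Y`, computed with any smooth extension of `Y` off `S`
(see `inducedDeriv_eq`). -/
def inducedDeriv (cov : Connection M) (S : Set M) (Y : Π x : M, TangentSpace (𝓡 4) x) (p : M) :
    TangentSpace (𝓡 4) p →L[ℝ] TangentSpace (𝓡 4) p :=
  if h : ∃ Z, IsVecExtensionAt S Y p Z then cov h.choose p else 0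

lemma cov_sum_smul (cov : Connection M) {p : M} {ι : Type*} (s : Finset ι) (f : ι → M → ℝ)
    (e : ι → Π x : M, TangentSpace (𝓡 4) x) (X : TangentSpace (𝓡 4) p)
    (hf : ∀ i, MDifferentiableAt (𝓡 4) 𝓘(ℝ, ℝ) (f i) p)
    (he : ∀ i, MDifferentiableAt (𝓡 4) ((𝓡 4).prod 𝓘(ℝ, E4))
      (fun x ↦ Bundle.TotalSpace.mk' E4 x (e i x)) p)
    (hf0 : ∀ i, f i p = 0) (hfX : ∀ i, mvfderiv (𝓡 4) (f i) p X = 0) :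
    MDifferentiableAt (𝓡 4) ((𝓡 4).prod 𝓘(ℝ, E4))
      (fun x ↦ Bundle.TotalSpace.mk' E4 x ((∑ i ∈ s, f i • e i) x)) p ∧
    cov (∑ i ∈ s, f i • e i) p X = 0 := by
  classical
  induction s using Finset.induction_on with
  | empty =>
    refine ⟨?_, ?_⟩
    · rw [Finset.sum_empty]
      exact Bundle.mdifferentiableAt_zeroSection ℝ (fun x : M ↦ TangentSpace (𝓡 4) x)
    · simp
  | insert a s ha ih =>
    have h1 : MDifferentiableAt (𝓡 4) ((𝓡 4).prod 𝓘(ℝ, E4))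
        (fun x ↦ Bundle.TotalSpace.mk' E4 x ((f a • e a) x)) p :=
      (hf a).smul_section (he a)
    rw [Finset.sum_insert ha]
    refine ⟨mdifferentiableAt_add_section h1 ih.1, ?_⟩
    rw [cov.isCovariantDerivativeOn.add h1 ih.1, cov.isCovariantDerivativeOn.leibniz (he a) (hf a)]
    simp [ih.2, hf0 a, hfX a]

/-- The tangential derivative of a smooth vector field that vanishes on `S` is zero. -/
lemma cov_eq_zero (cov : Connection M) {S : Set M} {p : M} (hp : p ∈ S)
    {X : TangentSpace (𝓡 4) p} (hX : X ∈ tangentTo S p) {Z : Π x : M, TangentSpace (𝓡 4) x}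
    (hZ : IsVecExtensionAt S (fun _ ↦ 0) p Z) : cov Z p X = 0 := by
  obtain ⟨U, hU, hpU, hZU, h0⟩ := hZ
  have : IsManifold (𝓡 4) (∞ + 1) M := by simpa using (inferInstance : IsManifold (𝓡 4) ∞ M)
  let e := trivializationAt E4 (TangentSpace (𝓡 4) : M → Type _) p
  let b := (EuclideanSpace.basisFun (Fin 4) ℝ).toBasis
  have hpe : p ∈ e.baseSet := FiberBundle.mem_baseSet_trivializationAt' p
  have hopen : IsOpen (U ∩ e.baseSet) := hU.inter e.open_baseSet
  let f : Fin 4 → M → ℝ := fun i x ↦ e.localFrameCoeff (𝓡 4) b i x (Z x)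
  have hfs (i) : ContMDiffOn (𝓡 4) 𝓘(ℝ, ℝ) ∞ (f i) (U ∩ e.baseSet) :=
    contMDiffOn_localFrameCoeff (k := ∞) b hopen Set.inter_subset_right
      (hZU.mono Set.inter_subset_left) i
  have hf0 (i) (x : M) (hx : x ∈ S ∩ (U ∩ e.baseSet)) : f i x = 0 := by
    have : Z x = 0 := h0 x ⟨hx.1, hx.2.1⟩
    simp [f, this]
  have hfd (i) : MDifferentiableAt (𝓡 4) 𝓘(ℝ, ℝ) (f i) p :=
    ((hfs i).contMDiffAt (hopen.mem_nhds ⟨hpU, hpe⟩)).mdifferentiableAt (by simp)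
  have hed (i) : MDifferentiableAt (𝓡 4) ((𝓡 4).prod 𝓘(ℝ, E4))
      (fun x ↦ Bundle.TotalSpace.mk' E4 x (e.localFrame b i x)) p :=
    (contMDiffAt_localFrame_of_mem 1 e b i hpe).mdifferentiableAt (by simp)
  have hmain := cov_sum_smul cov Finset.univ f (e.localFrame b) X hfd hed
    (fun i ↦ hf0 i p ⟨hp, hpU, hpe⟩)
    (fun i ↦ hX _ _ hopen ⟨hpU, hpe⟩ (hfs i) (fun x hx ↦ hf0 i x hx))
  have hZd : MDifferentiableAt (𝓡 4) ((𝓡 4).prod 𝓘(ℝ, E4))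
      (fun x ↦ Bundle.TotalSpace.mk' E4 x (Z x)) p :=
    (hZU.contMDiffAt (hU.mem_nhds hpU)).mdifferentiableAt (by simp)
  rw [cov.isCovariantDerivativeOn.congr_of_eventuallyEq hZd hmain.1 Filter.univ_mem, hmain.2]
  filter_upwards [e.eventually_eq_localFrame_sum_coeff_smul (I := 𝓡 4) (s := Z) b hpe] with x hx
  rw [hx]
  simp [f]

/-- The induced derivative does not depend on the extension. -/
theorem inducedDeriv_eq (cov : Connection M) {S : Set M} {p : M} (hp : p ∈ S)
    {X : TangentSpace (𝓡 4) p} (hX : X ∈ tangentTo S p) {Y Z : Π x : M, TangentSpace (𝓡 4) x}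
    (hZ : IsVecExtensionAt S Y p Z) : inducedDeriv cov S Y p X = cov Z p X := by
  have h : ∃ Z, IsVecExtensionAt S Y p Z := ⟨Z, hZ⟩
  rw [inducedDeriv, dif_pos h]
  obtain ⟨U, hU, hpU, hZU, hY⟩ := hZ
  obtain ⟨U', hU', hpU', hZU', hY'⟩ := h.choose_spec
  have hd1 : MDifferentiableAt (𝓡 4) ((𝓡 4).prod 𝓘(ℝ, E4))
      (fun x ↦ Bundle.TotalSpace.mk' E4 x (Z x)) p :=
    (hZU.contMDiffAt (hU.mem_nhds hpU)).mdifferentiableAt (by simp)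
  have hs : ContMDiffOn (𝓡 4) ((𝓡 4).prod 𝓘(ℝ, E4)) ∞
      (fun x ↦ Bundle.TotalSpace.mk' E4 x ((h.choose - Z) x)) (U' ∩ U) :=
    (hZU'.mono Set.inter_subset_left).sub_section (hZU.mono Set.inter_subset_right)
  have hd2 : MDifferentiableAt (𝓡 4) ((𝓡 4).prod 𝓘(ℝ, E4))
      (fun x ↦ Bundle.TotalSpace.mk' E4 x ((h.choose - Z) x)) p :=
    (hs.contMDiffAt ((hU'.inter hU).mem_nhds ⟨hpU', hpU⟩)).mdifferentiableAt (by simp)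
  have h0 : cov (h.choose - Z) p X = 0 := by
    refine cov_eq_zero cov hp hX ⟨U' ∩ U, hU'.inter hU, ⟨hpU', hpU⟩, hs, fun x hx ↦ ?_⟩
    simp [hY' x ⟨hx.1, hx.2.1⟩, hY x ⟨hx.1, hx.2.2⟩]
  have hadd := cov.isCovariantDerivativeOn.add (x := p) hd2 hd1
  rw [sub_add_cancel] at hadd
  rw [hadd, add_apply, h0, zero_add]

/-- The tangential derivative of a function on `S` does not depend on the extension. -/
theorem diffOn_eq {S : Set M} {p : M} {X : TangentSpace (𝓡 4) p} (hX : X ∈ tangentTo S p)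
    {f F : M → ℝ} (hF : IsFunExtensionAt S f p F) : diffOn S f p X = mvfderiv (𝓡 4) F p X := by
  have h : ∃ F, IsFunExtensionAt S f p F := ⟨F, hF⟩
  rw [diffOn, dif_pos h]
  obtain ⟨U, hU, hpU, hFU, hf⟩ := hF
  obtain ⟨U', hU', hpU', hFU', hf'⟩ := h.choose_spec
  have h0 := hX (U' ∩ U) (h.choose - F) (hU'.inter hU) ⟨hpU', hpU⟩
    ((hFU'.mono Set.inter_subset_left).sub (hFU.mono Set.inter_subset_right))
    (fun x hx ↦ by simp [hf' x ⟨hx.1, hx.2.1⟩, hf x ⟨hx.1, hx.2.2⟩])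
  rw [mvfderiv_sub ((hFU'.contMDiffAt (hU'.mem_nhds hpU')).mdifferentiableAt (by simp))
    ((hFU.contMDiffAt (hU.mem_nhds hpU)).mdifferentiableAt (by simp))] at h0
  simpa [sub_eq_zero] using h0

/-! ### Complex vectors, null tetrads, spin coefficients -/

/-- The complexification of a real vector space, elements being written `re + i im`. -/
@[ext]
structure CVec (V : Type*) where
  re : V
  im : V

/-- Complex conjugation. -/
def CVec.conj {V : Type*} [AddCommGroup V] (u : CVec V) : CVec V := ⟨u.re, -u.im⟩

/-- A real vector as a complex one. -/
def CVec.ofReal {V : Type*} [AddCommGroup V] (u : V) : CVec V := ⟨u, 0⟩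

/-- The complex bilinear extension of the metric. -/
def gC (g : LorentzMetric M) (x : M) (u w : CVec (TangentSpace (𝓡 4) x)) : ℂ :=
  ⟨g.val x u.re w.re - g.val x u.im w.im, g.val x u.re w.im + g.val x u.im w.re⟩

/-- The complex linear extension of the induced derivative: `u^a 𝒟_a Y^b` at `p`. -/
def derivC (cov : Connection M) (S : Set M) (Y : Π x : M, CVec (TangentSpace (𝓡 4) x)) (p : M)
    (u : CVec (TangentSpace (𝓡 4) p)) : CVec (TangentSpace (𝓡 4) p) :=
  ⟨inducedDeriv cov S (fun x ↦ (Y x).re) p u.re - inducedDeriv cov S (fun x ↦ (Y x).im) p u.im,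
    inducedDeriv cov S (fun x ↦ (Y x).re) p u.im + inducedDeriv cov S (fun x ↦ (Y x).im) p u.re⟩

/-- `(l, n, m, m̄)` is a Newman-Penrose null tetrad at `x`: `l·n = 1`, `m·m̄ = -1`, and all other
scalar products vanish. -/
structure IsNullTetrad (g : LorentzMetric M) (x : M) (l n : TangentSpace (𝓡 4) x)
    (m : CVec (TangentSpace (𝓡 4) x)) : Prop where
  ll : g.val x l l = 0
  nn : g.val x n n = 0
  ln : g.val x l n = 1
  lm : gC g x (CVec.ofReal l) m = 0
  nm : gC g x (CVec.ofReal n) m = 0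
  mm : gC g x m m = 0
  mmbar : gC g x m m.conj = -1

/-- The expansion `q^{ab} ∇_a l_b` with `q^{ab} = - m^a m̄^b - m̄^a m^b`. -/
def expansion (g : LorentzMetric M) (cov : Connection M) (S : Set M)
    (l : Π x : M, TangentSpace (𝓡 4) x) (p : M) (m : CVec (TangentSpace (𝓡 4) p)) : ℂ :=
  - gC g p m.conj (derivC cov S (fun x ↦ CVec.ofReal (l x)) p m)
    - gC g p m (derivC cov S (fun x ↦ CVec.ofReal (l x)) p m.conj)

/-- The spin coefficient `ε = (n_a D l^a - m̄_a D m^a) / 2`, where `D = l^a ∇_a`. -/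
def spinEps (g : LorentzMetric M) (cov : Connection M) (S : Set M)
    (l n : Π x : M, TangentSpace (𝓡 4) x) (m : Π x : M, CVec (TangentSpace (𝓡 4) x)) (p : M) : ℂ :=
  (gC g p (CVec.ofReal (n p))
      (derivC cov S (fun x ↦ CVec.ofReal (l x)) p (CVec.ofReal (l p)))
    - gC g p (m p).conj (derivC cov S m p (CVec.ofReal (l p)))) / 2

/-- The spin coefficient `π = - m̄_a D n^a`, where `D = l^a ∇_a`. -/
def spinPi (g : LorentzMetric M) (cov : Connection M) (S : Set M)
    (l n : Π x : M, TangentSpace (𝓡 4) x) (m : Π x : M, CVec (TangentSpace (𝓡 4) x)) (p : M) : ℂ :=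
  - gC g p (m p).conj (derivC cov S (fun x ↦ CVec.ofReal (n x)) p (CVec.ofReal (l p)))

/-! ### Non-expanding horizons -/

/-- A null hypersurface: at each point some nonzero tangent vector is orthogonal to the whole
tangent space, i.e. the induced metric is degenerate. -/
def IsNullHypersurface (g : LorentzMetric M) (S : Set M) : Prop :=
  IsHypersurface S ∧
    ∀ p ∈ S, ∃ L ∈ tangentTo S p, L ≠ 0 ∧ ∀ X ∈ tangentTo S p, g.val p L X = 0

/-- `l` is a smooth, nowhere vanishing field along `S` that is normal to `S`. -/
structure IsNormalField (g : LorentzMetric M) (S : Set M)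
    (l : Π x : M, TangentSpace (𝓡 4) x) : Prop where
  smooth : SmoothVecOn S l
  ne_zero : ∀ p ∈ S, l p ≠ 0
  normal : ∀ p ∈ S, ∀ X ∈ tangentTo S p, g.val p (l p) X = 0

/-- `S` is a non-expanding horizon in the space-time with metric `g`, time orientation `t`,
Levi-Civita connection `cov` and energy-momentum tensor `T`. -/
structure IsNonExpandingHorizon (g : LorentzMetric M) (t : TimeOrientation g)
    (cov : Connection M)
    (T : Π x : M, TangentSpace (𝓡 4) x →L[ℝ] TangentSpace (𝓡 4) x →L[ℝ] ℝ)
    (S : Set M) : Prop where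
  null : IsNullHypersurface g S
  topology : Nonempty (S ≃ₜ ℝ × Metric.sphere (0 : EuclideanSpace ℝ (Fin 3)) 1)
  expansion_eq_zero : ∀ l, IsNormalField g S l → ∀ p ∈ S, ∀ n m, IsNullTetrad g p (l p) n m →
    expansion g cov S l p m = 0
  einstein : ∀ p ∈ S, EinsteinAt g cov T p
  /-- For a future pointing null normal `L`, the vector `V^a = T^a_b L^b` is future pointing. -/
  energy : ∀ p ∈ S, ∀ L : TangentSpace (𝓡 4) p, L ≠ 0 → (∀ X ∈ tangentTo S p, g.val p L X = 0) →
    FutureCausal t p L → ∀ V : TangentSpace (𝓡 4) p, (∀ w, g.val p V w = T p w L) →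
      FutureCausal t p V

/-! ### Adapted tetrads -/

/-- `v` is a smooth function on `S` with `D v = l^a ∇_a v = 1`; its level sets are the cuts of
`S`. -/
def IsParameter (S : Set M) (l : Π x : M, TangentSpace (𝓡 4) x) (v : M → ℝ) : Prop :=
  SmoothFunOn S v ∧ ∀ p ∈ S, diffOn S v p (l p) = 1

/-- `(l, n, m, m̄)` is a smooth null tetrad on the part of `S` lying in the open set `U`, adapted to
the null normal `l` and to the parameter `v`: the vectors `m`, `m̄` are tangent to the cuts
`v = const` and Lie dragged along `l`. Since only derivatives tangent to `S` are used on `S`, the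
tetrad need not be given off `S`. (It is local in `S`, as `m` cannot be
defined continuously on a whole sphere.) -/
structure IsAdaptedTetrad (g : LorentzMetric M) (cov : Connection M) (S : Set M)
    (l : Π x : M, TangentSpace (𝓡 4) x) (v : M → ℝ) (U : Set M)
    (n : Π x : M, TangentSpace (𝓡 4) x) (m : Π x : M, CVec (TangentSpace (𝓡 4) x)) : Prop where
  smooth_n : SmoothVecOn (S ∩ U) n
  smooth_m_re : SmoothVecOn (S ∩ U) (fun x ↦ (m x).re)
  smooth_m_im : SmoothVecOn (S ∩ U) (fun x ↦ (m x).im)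
  tetrad : ∀ p ∈ S ∩ U, IsNullTetrad g p (l p) (n p) (m p)
  tangent_cut : ∀ p ∈ S ∩ U, diffOn S v p (m p).re = 0 ∧ diffOn S v p (m p).im = 0
  /-- `£_l m^a = l^b ∇_b m^a - m^b ∇_b l^a = 0`. -/
  lie_dragged : ∀ p ∈ S ∩ U, derivC cov S m p (CVec.ofReal (l p)) =
    derivC cov S (fun x ↦ CVec.ofReal (l x)) p (m p)

/-- The 1-form `(ε + ε̄) n_a - π m_a - π̄ m̄_a` of a tetrad at the point `p`, evaluated on `Y`. -/
def tetradForm (g : LorentzMetric M) (cov : Connection M) (S : Set M)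
    (l n : Π x : M, TangentSpace (𝓡 4) x) (m : Π x : M, CVec (TangentSpace (𝓡 4) x)) (p : M)
    (Y : TangentSpace (𝓡 4) p) : ℂ :=
  (spinEps g cov S l n m p + star (spinEps g cov S l n m p)) *
      gC g p (CVec.ofReal (n p)) (CVec.ofReal Y)
    - spinPi g cov S l n m p * gC g p (m p) (CVec.ofReal Y)
    - star (spinPi g cov S l n m p) * gC g p (m p).conj (CVec.ofReal Y)

/-- `rot` is a smooth 1-form along `S` with `𝒟_a l^b = rot_a l^b` on `S`. -/
def IsRotationalForm (cov : Connection M) (S : Set M) (l : Π x : M, TangentSpace (𝓡 4) x)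
    (rot : Π x : M, TangentSpace (𝓡 4) x →L[ℝ] ℝ) : Prop :=
  SmoothFormOn S rot ∧ ∀ p ∈ S, ∀ X ∈ tangentTo S p, inducedDeriv cov S l p X = rot p X • l p

end Manifold

end Horizon

end

/-! Near each point of `S` replace `l` by a globally smooth field `Z` that agrees with it on `S`,
and put `B(X,Y) = g(∇_X Z, Y)` for `X`, `Y` tangent to `S`. The tangent space of `S` is `l^⊥`. Since
brackets of tangent fields are tangent, `B` is symmetric; since `l·l = 0` on `S`, it annihilates
`l`. So `B` amounts to a symmetric 2×2 matrix in two spacelike directions, whose trace is the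
expansion up to sign, hence zero.

Differentiating the vanishing trace along `l` gives Raychaudhuri's equation in the form `Ric(l,l) +
|B|² = 0`, where `|B|²` is a sum of squares. Einstein's equations and the energy condition give
`Ric(l,l) ≥ 0` (`IsNonExpandingHorizon.ricci_nonneg`), so `B = 0` (`val_cov_eq_zero`). Thus `∇_X l`
is orthogonal to `l^⊥`, i.e. a multiple of `l`, with coefficient `n·∇_X l` for any `n` with `l·n =
1` (`inducedDeriv_normal`). Extending this coefficient by zero on `n` gives a covector field of the
space-time (`rotForm`).

Given `v`, there is only one null `n` with `l·n = 1` orthogonal to the cuts (`cutNormal`), and every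
adapted tetrad contains it, so a single form `ω` serves all tetrads. The condition that `m` is Lie
dragged becomes `Dm = ω(m) l`, which yields `ω(l) = ε + ε̄` and `ω(m̄) = π`; together with `ω(n) =
0` this is the stated formula (`rotForm_eq_tetradForm`). -/

noncomputable section

namespace Horizon

set_option linter.unusedSectionVars false

/-! ### Globally smooth fields: localisation, connection and bracket calculus -/

section SmoothFields

variable {M : Type*} [TopologicalSpace M] [ChartedSpace E4 M] [IsManifold (𝓡 4) ∞ M]

/-- A smooth vector field on the whole space-time. -/
def IsSmoothVec (X : Π x : M, TangentSpace (𝓡 4) x) : Prop :=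
  ContMDiff (𝓡 4) ((𝓡 4).prod 𝓘(ℝ, E4)) ∞ (fun x ↦ Bundle.TotalSpace.mk' E4 x (X x))

/-- A smooth function on the whole space-time. -/
def IsSmoothFun (f : M → ℝ) : Prop := ContMDiff (𝓡 4) 𝓘(ℝ, ℝ) ∞ f

lemma IsSmoothVec.mdifferentiableAt {X : Π x : M, TangentSpace (𝓡 4) x} (hX : IsSmoothVec X)
    (x : M) : MDifferentiableAt (𝓡 4) ((𝓡 4).prod 𝓘(ℝ, E4))
      (fun y ↦ Bundle.TotalSpace.mk' E4 y (X y)) x :=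
  (ContMDiff.contMDiffAt hX).mdifferentiableAt (by simp)

lemma IsSmoothFun.mdifferentiableAt {f : M → ℝ} (hf : IsSmoothFun f) (x : M) :
    MDifferentiableAt (𝓡 4) 𝓘(ℝ, ℝ) f x :=
  (ContMDiff.contMDiffAt hf).mdifferentiableAt (by simp)

lemma IsSmoothVec.add {X Y : Π x : M, TangentSpace (𝓡 4) x} (hX : IsSmoothVec X)
    (hY : IsSmoothVec Y) : IsSmoothVec (X + Y) := ContMDiff.add_section hX hY

lemma IsSmoothVec.sub {X Y : Π x : M, TangentSpace (𝓡 4) x} (hX : IsSmoothVec X)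
    (hY : IsSmoothVec Y) : IsSmoothVec (X - Y) := ContMDiff.sub_section hX hY

lemma IsSmoothVec.smul {f : M → ℝ} {X : Π x : M, TangentSpace (𝓡 4) x} (hf : IsSmoothFun f)
    (hX : IsSmoothVec X) : IsSmoothVec (f • X) := ContMDiff.smul_section hf hX

lemma IsSmoothVec.sum {ι : Type*} {s : Finset ι} {X : ι → Π x : M, TangentSpace (𝓡 4) x}
    (hX : ∀ i, IsSmoothVec (X i)) : IsSmoothVec (∑ i ∈ s, X i) := by
  have := ContMDiff.sum_section (s := s) (t := X) (fun i _ ↦ hX i)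
  unfold IsSmoothVec
  simpa only [Finset.sum_apply] using this

lemma isSmoothFun_const (c : ℝ) : IsSmoothFun (fun _ : M ↦ c) := contMDiff_const

lemma IsSmoothFun.add {f h : M → ℝ} (hf : IsSmoothFun f) (hh : IsSmoothFun h) :
    IsSmoothFun (f + h) := ContMDiff.add hf hh

lemma IsSmoothFun.sub {f h : M → ℝ} (hf : IsSmoothFun f) (hh : IsSmoothFun h) :
    IsSmoothFun (f - h) := ContMDiff.sub hf hh

lemma IsSmoothFun.mul {f h : M → ℝ} (hf : IsSmoothFun f) (hh : IsSmoothFun h) :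
    IsSmoothFun (f * h) := ContMDiff.mul hf hh

lemma IsSmoothFun.div {f h : M → ℝ} (hf : IsSmoothFun f) (hh : IsSmoothFun h)
    (h0 : ∀ x, h x ≠ 0) : IsSmoothFun (f / h) := ContMDiff.div₀ hf hh h0

lemma IsSmoothFun.metric (g : LorentzMetric M) {X Y : Π x : M, TangentSpace (𝓡 4) x}
    (hX : IsSmoothVec X) (hY : IsSmoothVec Y) : IsSmoothFun (fun x ↦ g.val x (X x) (Y x)) := by
  have := ContMDiff.clm_bundle_apply₂ (F₃ := ℝ) (E₃ := Bundle.Trivial M ℝ) g.smooth hX hY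
  intro x
  exact (Bundle.contMDiffAt_totalSpace.1 (this x)).2

lemma IsSmoothVec.cov {g : LorentzMetric M} {cov : Connection M} (hcov : IsLeviCivita g cov)
    {X Y : Π x : M, TangentSpace (𝓡 4) x} (hX : IsSmoothVec X) (hY : IsSmoothVec Y) :
    IsSmoothVec (fun x ↦ cov Y x (X x)) := by
  have h := hcov.smooth.contMDiff.contMDiff (σ := Y) (by simpa using ContMDiff.contMDiffOn hY)
  exact ContMDiff.clm_bundle_apply (contMDiffOn_univ.1 h) hX

/-- Every field that is smooth on an open set agrees near each of its points with a smooth field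
defined everywhere. -/
lemma exists_isSmoothVec_eventuallyEq [T2Space M] {U : Set M} (hU : IsOpen U) {p : M} (hp : p ∈ U)
    {X : Π x : M, TangentSpace (𝓡 4) x}
    (hX : ContMDiffOn (𝓡 4) ((𝓡 4).prod 𝓘(ℝ, E4)) ∞
      (fun x ↦ Bundle.TotalSpace.mk' E4 x (X x)) U) :
    ∃ Y, IsSmoothVec Y ∧ ∀ᶠ x in 𝓝 p, Y x = X x := by
  obtain ⟨f, -, hf⟩ := (SmoothBumpFunction.nhds_basis_tsupport (I := 𝓡 4) p).mem_iff.1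
    (hU.mem_nhds hp)
  refine ⟨(f : M → ℝ) • X, ContMDiffOn.smul_section_of_tsupport f.contMDiff.contMDiffOn hU hf hX, ?_⟩
  filter_upwards [f.eventuallyEq_one] with x hx
  simp [hx]

lemma exists_isSmoothFun_eventuallyEq [T2Space M] {U : Set M} (hU : IsOpen U) {p : M} (hp : p ∈ U)
    {F : M → ℝ} (hF : ContMDiffOn (𝓡 4) 𝓘(ℝ, ℝ) ∞ F U) :
    ∃ G, IsSmoothFun G ∧ ∀ᶠ x in 𝓝 p, G x = F x := by
  obtain ⟨f, -, hf⟩ := (SmoothBumpFunction.nhds_basis_tsupport (I := 𝓡 4) p).mem_iff.1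
    (hU.mem_nhds hp)
  refine ⟨fun x ↦ f x • F x, contMDiff_of_tsupport fun x hx ↦ ?_, ?_⟩
  · have hxU : x ∈ U := hf (tsupport_smul_subset_left _ _ hx)
    exact f.contMDiffAt.smul (hF.contMDiffAt (hU.mem_nhds hxU))
  filter_upwards [f.eventuallyEq_one] with x hx
  simp [hx]

lemma exists_isSmoothVec_extend [T2Space M] {p : M} (v : TangentSpace (𝓡 4) p) :
    ∃ Y, IsSmoothVec Y ∧ ∀ᶠ x in 𝓝 p, Y x = FiberBundle.extend E4 v x := by
  have : IsManifold (𝓡 4) (∞ + 1) M := by simpa using (inferInstance : IsManifold (𝓡 4) ∞ M)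
  obtain ⟨s, hs, h⟩ := FiberBundle.exists_contMDiffOn_extend (k := ∞) (𝓡 4) E4 v
  exact exists_isSmoothVec_eventuallyEq isOpen_interior (mem_interior_iff_mem_nhds.2 hs)
    (h.mono interior_subset)

lemma exists_isSmoothVec_apply_eq [T2Space M] {p : M} (v : TangentSpace (𝓡 4) p) :
    ∃ Y, IsSmoothVec Y ∧ Y p = v := by
  obtain ⟨Y, hY, h⟩ := exists_isSmoothVec_extend v
  exact ⟨Y, hY, by simpa using h.self_of_nhds⟩

/-- A smooth cutoff function at `p` supported in a given neighbourhood of `p`. -/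
lemma exists_cutoff [T2Space M] {p : M} {s : Set M} (hs : s ∈ 𝓝 p) :
    ∃ χ : M → ℝ, IsSmoothFun χ ∧ χ p = 1 ∧ ∀ x ∉ s, χ x = 0 := by
  obtain ⟨f, -, hf⟩ := (SmoothBumpFunction.nhds_basis_tsupport (I := 𝓡 4) p).mem_iff.1 hs
  exact ⟨f, f.contMDiff, f.eq_one, fun x hx ↦ image_eq_zero_of_notMem_tsupport fun h ↦ hx (hf h)⟩

lemma mvfderiv_congr {f h : M → ℝ} {p : M} (hfh : ∀ᶠ x in 𝓝 p, f x = h x) :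
    mvfderiv (𝓡 4) f p = mvfderiv (𝓡 4) h p := by
  unfold mvfderiv
  ext v
  have : f p = h p := hfh.self_of_nhds
  simp [Filter.EventuallyEq.mfderiv_eq (I := 𝓡 4) (I' := 𝓘(ℝ, ℝ)) hfh]
  rfl

lemma Connection.congr (cov : Connection M) {X Y : Π x : M, TangentSpace (𝓡 4) x} {p : M}
    (hX : MDifferentiableAt (𝓡 4) ((𝓡 4).prod 𝓘(ℝ, E4)) (fun x ↦ Bundle.TotalSpace.mk' E4 x (X x)) p)
    (hXY : ∀ᶠ x in 𝓝 p, Y x = X x) : cov Y p = cov X p := by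
  have hY : MDifferentiableAt (𝓡 4) ((𝓡 4).prod 𝓘(ℝ, E4))
      (fun x ↦ Bundle.TotalSpace.mk' E4 x (Y x)) p :=
    hX.congr_of_eventuallyEq (by filter_upwards [hXY] with x hx; rw [hx])
  exact cov.isCovariantDerivativeOn.congr_of_eventuallyEq hY hX Filter.univ_mem hXY

section Rules

variable (cov : Connection M) {X Y Z : Π x : M, TangentSpace (𝓡 4) x} {f h : M → ℝ}

lemma Connection.apply_add (hX : IsSmoothVec X) (hY : IsSmoothVec Y) (p : M) :
    cov (X + Y) p = cov X p + cov Y p :=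
  cov.isCovariantDerivativeOn.add (hX.mdifferentiableAt p) (hY.mdifferentiableAt p)

lemma Connection.apply_smul (hf : IsSmoothFun f) (hX : IsSmoothVec X) (p : M)
    (v : TangentSpace (𝓡 4) p) :
    cov (f • X) p v = f p • cov X p v + mvfderiv (𝓡 4) f p v • X p := by
  rw [cov.isCovariantDerivativeOn.leibniz (hX.mdifferentiableAt p) (hf.mdifferentiableAt p)]
  simp

lemma IsLeviCivita.mvfderiv_metric {g : LorentzMetric M} {cov : Connection M}
    (hcov : IsLeviCivita g cov) (hX : IsSmoothVec X) (hY : IsSmoothVec Y) (p : M)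
    (v : TangentSpace (𝓡 4) p) : mvfderiv (𝓡 4) (fun y ↦ g.val y (X y) (Y y)) p v =
      g.val p (cov X p v) (Y p) + g.val p (X p) (cov Y p v) :=
  hcov.metric p X Y v (hX.mdifferentiableAt p) (hY.mdifferentiableAt p)

lemma IsLeviCivita.cov_sub_cov {g : LorentzMetric M} {cov : Connection M}
    (hcov : IsLeviCivita g cov) (hX : IsSmoothVec X) (hY : IsSmoothVec Y) (p : M) :
    cov Y p (X p) - cov X p (Y p) = VectorField.mlieBracket (𝓡 4) X Y p :=
  cov.torsion_eq_zero_iff.1 hcov.torsion_free (hX.mdifferentiableAt p) (hY.mdifferentiableAt p)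

lemma IsSmoothVec.mlieBracket (hX : IsSmoothVec X) (hY : IsSmoothVec Y) :
    IsSmoothVec (VectorField.mlieBracket (𝓡 4) X Y) := by
  have : IsManifold (𝓡 4) (((⊤ : ℕ∞) : WithTop ℕ∞) + 1) M := by
    simpa using (inferInstance : IsManifold (𝓡 4) ∞ M)
  have : IsManifold (𝓡 4) (minSmoothness ℝ 2) M := by
    rw [minSmoothness_of_isRCLikeNormedField]; infer_instance
  intro x
  exact ContMDiffAt.mlieBracket_vectorField (n := (⊤ : ℕ∞)) (m := (⊤ : ℕ∞)) (hX x) (hY x) (by simp)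

/-- The Leibniz rule isolates the derivative: `∇_X (f t) - f ∇_X t = X(f) t`. Pairing with the
timelike field `t` and dividing by `g(t,t) > 0` expresses `X(f)` through operations already known to
preserve smoothness. -/
lemma IsSmoothFun.mvfderiv {g : LorentzMetric M} (t : TimeOrientation g) {cov : Connection M}
    (hcov : IsLeviCivita g cov) (hf : IsSmoothFun f) (hX : IsSmoothVec X) :
    IsSmoothFun (fun x ↦ mvfderiv (𝓡 4) f x (X x)) := by
  have ht : IsSmoothVec t.field := t.smooth
  have h := (((hX.cov hcov (ht.smul hf)).sub ((hX.cov hcov ht).smul hf) : IsSmoothVec _))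
  have h2 := (IsSmoothFun.metric g h ht).div (IsSmoothFun.metric g ht ht)
    (fun x ↦ (t.timelike x).ne')
  convert h2 using 1
  ext x
  have := (t.timelike x).ne'
  simp [Connection.apply_smul cov hf ht]
  field_simp

/-- Take a field `W` with `W p ≠ 0` and subtract `f` times the Jacobi identity for `X`, `Y`, `W`
from the one for `X`, `Y`, `f W`; what is left is this identity times `W p`. -/
lemma mvfderiv_mlieBracket [T2Space M] (hf : IsSmoothFun f) (hX : IsSmoothVec X)
    (hY : IsSmoothVec Y)
    (hXf : IsSmoothFun fun x ↦ mvfderiv (𝓡 4) f x (X x))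
    (hYf : IsSmoothFun fun x ↦ mvfderiv (𝓡 4) f x (Y x)) (p : M) :
    mvfderiv (𝓡 4) f p (VectorField.mlieBracket (𝓡 4) X Y p) =
      mvfderiv (𝓡 4) (fun x ↦ mvfderiv (𝓡 4) f x (Y x)) p (X p) -
        mvfderiv (𝓡 4) (fun x ↦ mvfderiv (𝓡 4) f x (X x)) p (Y p) := by
  have : IsManifold (𝓡 4) (minSmoothness ℝ 3) M := by
    simpa using IsManifold.of_le (I := 𝓡 4) (M := M) (m := 3) (n := ∞) (by exact WithTop.coe_le_coe.2 le_top)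
  obtain ⟨v, hv⟩ : ∃ v : TangentSpace (𝓡 4) p, v ≠ 0 := exists_ne (0 : E4)
  obtain ⟨W, hW, rfl⟩ := exists_isSmoothVec_apply_eq v
  have h2 {V : Π x : M, TangentSpace (𝓡 4) x} (hV : IsSmoothVec V) :
      ContMDiffAt (𝓡 4) ((𝓡 4).prod 𝓘(ℝ, E4)) (minSmoothness ℝ 2)
        (fun x ↦ Bundle.TotalSpace.mk' E4 x (V x)) p :=
    (hV p).of_le (by simpa using by exact WithTop.coe_le_coe.2 le_top)
  have key := VectorField.leibniz_identity_mlieBracket_apply (h2 hX) (h2 hY) (h2 (hW.smul hf))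
  have key' := VectorField.leibniz_identity_mlieBracket_apply (h2 hX) (h2 hY) (h2 hW)
  have e1 (V : Π x : M, TangentSpace (𝓡 4) x) : VectorField.mlieBracket (𝓡 4) V (f • W) =
      (fun x ↦ mvfderiv (𝓡 4) f x (V x)) • W + f • VectorField.mlieBracket (𝓡 4) V W := by
    ext1 x
    rw [VectorField.mlieBracket_smul_right (hf.mdifferentiableAt x) (hW.mdifferentiableAt x)]
    rfl
  rw [e1, e1, e1] at key
  have hm (V : Π x : M, TangentSpace (𝓡 4) x) (hV : IsSmoothVec V) {h : M → ℝ}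
      (hh : IsSmoothFun h) (U) := VectorField.mlieBracket_smul_right (I := 𝓡 4) (V := U)
        (hh.mdifferentiableAt p) (hV.mdifferentiableAt p)
  rw [VectorField.mlieBracket_add_right ((hW.smul hYf).mdifferentiableAt p)
      (((hY.mlieBracket hW).smul hf).mdifferentiableAt p),
    VectorField.mlieBracket_add_right ((hW.smul hXf).mdifferentiableAt p)
      (((hX.mlieBracket hW).smul hf).mdifferentiableAt p),
    hm _ hW hYf, hm _ hW hXf, hm _ (hY.mlieBracket hW) hf, hm _ (hX.mlieBracket hW) hf, key'] at key
  simp only [Pi.add_apply, Pi.smul_apply', smul_add] at key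
  refine smul_left_injective ℝ hv ?_
  simp only [sub_smul]
  rw [← sub_eq_zero] at key ⊢
  rw [← neg_eq_zero, ← key]
  abel

end Rules

end SmoothFields

/-! ### Pointwise Lorentzian algebra: orthonormal frames, causal vectors, null tetrads -/

section LorentzAlgebra

variable {M : Type*} [TopologicalSpace M] [ChartedSpace E4 M] [IsManifold (𝓡 4) ∞ M]
  (g : LorentzMetric M) {x : M}

lemma finrank_tangentSpace (x : M) : Module.finrank ℝ (TangentSpace (𝓡 4) x) = 4 := by
  change Module.finrank ℝ E4 = 4
  simp

instance (x : M) : FiniteDimensional ℝ (TangentSpace (𝓡 4) x) :=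
  inferInstanceAs (FiniteDimensional ℝ E4)

/-- The vectors `e i` form an orthonormal frame of the tangent space. -/
def LorentzMetric.IsOrthonormal (e : Fin 4 → TangentSpace (𝓡 4) x) : Prop :=
  ∀ i j, g.val x (e i) (e j) = if i = j then sgn i else 0

lemma LorentzMetric.isOrthonormal_frame (x : M) : g.IsOrthonormal (g.frame x) :=
  (g.signature x).choose_spec

variable {g}

lemma sgn_mul_self (i : Fin 4) : sgn i * sgn i = 1 := by
  unfold sgn; split_ifs <;> norm_num

lemma sum_sgn (c : Fin 4 → ℝ) : ∑ i, sgn i * c i = c 0 - c 1 - c 2 - c 3 := by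
  simp [Fin.sum_univ_four, sgn]; ring

lemma LorentzMetric.IsOrthonormal.eq_sum {e : Fin 4 → TangentSpace (𝓡 4) x}
    (he : g.IsOrthonormal e) (v : TangentSpace (𝓡 4) x) :
    v = ∑ i, (sgn i * g.val x v (e i)) • e i := by
  have hc (c : Fin 4 → ℝ) (j : Fin 4) : sgn j * g.val x (∑ i, c i • e i) (e j) = c j := by
    simp only [map_sum, map_smul, sum_apply, smul_apply, he _ j]
    simp [mul_comm (c j), ← mul_assoc, sgn_mul_self]
  have hli : LinearIndependent ℝ e := by
    refine Fintype.linearIndependent_iff.2 fun c h j ↦ ?_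
    rw [← hc c j, h]
    simp
  let b := basisOfLinearIndependentOfCardEqFinrank hli (by simp [finrank_tangentSpace])
  have hb : v = ∑ i, b.repr v i • e i := by
    conv_lhs => rw [← b.sum_repr v]
    simp [b]
  conv_rhs => rw [hb]
  simp only [hc]
  exact hb

lemma LorentzMetric.IsOrthonormal.val_eq {e : Fin 4 → TangentSpace (𝓡 4) x}
    (he : g.IsOrthonormal e) (v w : TangentSpace (𝓡 4) x) :
    g.val x v w = ∑ i, sgn i * (g.val x v (e i) * g.val x w (e i)) := by
  conv_lhs => rw [he.eq_sum v]
  simp only [map_sum, map_smul, sum_apply, smul_apply, smul_eq_mul]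
  exact Finset.sum_congr rfl fun i _ ↦ by rw [g.symm x (e i) w]; ring

lemma LorentzMetric.eq_zero_of_forall {v : TangentSpace (𝓡 4) x} (h : ∀ w, g.val x v w = 0) :
    v = 0 := by
  rw [(g.isOrthonormal_frame x).eq_sum v]
  simp [h]

lemma LorentzMetric.eq_of_forall {v v' : TangentSpace (𝓡 4) x}
    (h : ∀ w, g.val x v w = g.val x v' w) : v = v' :=
  sub_eq_zero.1 (g.eq_zero_of_forall fun w ↦ by simp [h w])

/-- The trace of an endomorphism can be computed in any orthonormal frame. -/
lemma LorentzMetric.IsOrthonormal.sum_val_eq {e f : Fin 4 → TangentSpace (𝓡 4) x}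
    (he : g.IsOrthonormal e) (hf : g.IsOrthonormal f)
    (R : TangentSpace (𝓡 4) x →ₗ[ℝ] TangentSpace (𝓡 4) x) :
    ∑ i, sgn i * g.val x (R (e i)) (e i) = ∑ i, sgn i * g.val x (R (f i)) (f i) := by
  have h1 (i : Fin 4) : g.val x (R (e i)) (e i) =
      ∑ j, sgn j * (g.val x (R (e i)) (f j) * g.val x (e i) (f j)) := hf.val_eq _ _
  have h2 (j : Fin 4) : g.val x (R (f j)) (f j) =
      ∑ i, sgn i * (g.val x (R (e i)) (f j) * g.val x (e i) (f j)) := by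
    conv_lhs => rw [he.eq_sum (f j), ← he.eq_sum (f j)]
    conv_lhs => enter [1]; rw [he.eq_sum (f j)]
    simp only [map_sum, map_smul, sum_apply, smul_apply, smul_eq_mul]
    exact Finset.sum_congr rfl fun i _ ↦ by rw [g.symm x (f j) (e i)]; ring
  simp only [h1, h2, Finset.mul_sum]
  rw [Finset.sum_comm]
  exact Finset.sum_congr rfl fun _ _ ↦ Finset.sum_congr rfl fun _ _ ↦ by ring

/-- The orthogonal complement of a timelike vector contains no nonzero causal vector. -/
lemma LorentzMetric.eq_zero_of_timelike {t v : TangentSpace (𝓡 4) x} (ht : 0 < g.val x t t)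
    (htv : g.val x t v = 0) (hv : 0 ≤ g.val x v v) : v = 0 := by
  have he := g.isOrthonormal_frame x
  rw [he.val_eq, sum_sgn] at ht htv hv
  have h0 : v = ∑ i, (sgn i * g.val x v (g.frame x i)) • g.frame x i := he.eq_sum v
  generalize hV : (fun i ↦ g.val x v (g.frame x i)) = V
  generalize hT : (fun i ↦ g.val x t (g.frame x i)) = T
  have hV' (i) : g.val x v (g.frame x i) = V i := by rw [← hV]
  have hT' (i) : g.val x t (g.frame x i) = T i := by rw [← hT]
  simp only [hV', hT'] at ht htv hv h0
  -- Cauchy–Schwarz for the spatial parts, through Lagrange's identity; orthogonality turns the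
  -- spatial product into `T 0 * V 0`.
  have hcs : (T 0 * V 0) ^ 2 ≤
      (T 1 ^ 2 + T 2 ^ 2 + T 3 ^ 2) * (V 1 ^ 2 + V 2 ^ 2 + V 3 ^ 2) := by
    have : T 0 * V 0 = T 1 * V 1 + T 2 * V 2 + T 3 * V 3 := by linarith
    rw [this]
    nlinarith [sq_nonneg (T 1 * V 2 - T 2 * V 1), sq_nonneg (T 1 * V 3 - T 3 * V 1),
      sq_nonneg (T 2 * V 3 - T 3 * V 2)]
  have hS : V 1 ^ 2 + V 2 ^ 2 + V 3 ^ 2 ≤ V 0 ^ 2 := by linarith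
  have hV0 : V 0 = 0 := by
    by_contra h
    have h1 : 0 < V 0 ^ 2 := by positivity
    have h2 := mul_le_mul_of_nonneg_left hS
      (by positivity : 0 ≤ T 1 ^ 2 + T 2 ^ 2 + T 3 ^ 2)
    have h3 : 0 < (T 0 ^ 2 - (T 1 ^ 2 + T 2 ^ 2 + T 3 ^ 2)) * V 0 ^ 2 :=
      mul_pos (by linarith) h1
    linarith [mul_pow (T 0) (V 0) 2]
  rw [hV0] at hS
  have hV1 : V 1 = 0 := by nlinarith [sq_nonneg (V 1), sq_nonneg (V 2), sq_nonneg (V 3)]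
  have hV2 : V 2 = 0 := by nlinarith [sq_nonneg (V 1), sq_nonneg (V 2), sq_nonneg (V 3)]
  have hV3 : V 3 = 0 := by nlinarith [sq_nonneg (V 1), sq_nonneg (V 2), sq_nonneg (V 3)]
  rw [h0]
  simp [Fin.sum_univ_four, hV0, hV1, hV2, hV3]

/-- Two future pointing causal vectors have a nonnegative scalar product. -/
lemma FutureCausal.val_nonneg {t : TimeOrientation g} {v w : TangentSpace (𝓡 4) x}
    (hv : FutureCausal t x v) (hw : FutureCausal t x w) : 0 ≤ g.val x v w := by
  by_contra! h
  have ht := t.timelike x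
  have pos {v : TangentSpace (𝓡 4) x} (hv : FutureCausal t x v) (hv0 : v ≠ 0) :
      0 < g.val x v (t.field x) :=
    hv.2.lt_of_ne fun h0 ↦ hv0 (g.eq_zero_of_timelike ht (by rw [g.symm, ← h0]) hv.1)
  have hv' := pos hv (by rintro rfl; simp at h)
  have hw' := pos hw (by rintro rfl; simp at h)
  set a := g.val x v (t.field x) with ha
  set b := g.val x w (t.field x) with hb
  have hX : g.val x (b • v - a • w) (b • v - a • w) =
      b ^ 2 * g.val x v v - 2 * (a * b) * g.val x v w + a ^ 2 * g.val x w w := by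
    simp only [map_sub, map_smul, sub_apply, smul_apply, smul_eq_mul, g.symm x w v]
    ring
  -- The combination `b v - a w` is orthogonal to the time orientation. If `g(v,w)` were negative,
  -- it would be timelike, which is impossible for such a vector.
  have hpos : 0 < g.val x (b • v - a • w) (b • v - a • w) := by
    rw [hX]
    have h1 := mul_nonneg (sq_nonneg b) hv.1
    have h2 := mul_nonneg (sq_nonneg a) hw.1
    nlinarith [mul_pos hv' hw']
  have := g.eq_zero_of_timelike ht (v := b • v - a • w) (by
    rw [g.symm]
    simp only [map_sub, map_smul, sub_apply, smul_apply, smul_eq_mul, ← ha, ← hb]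
    ring) hpos.le
  rw [this] at hpos
  simp at hpos

/-- A real null tetrad: `l·n = 1`, `a·a = b·b = -1`, and all other products vanish. -/
structure IsRealTetrad (g : LorentzMetric M) (x : M) (l n a b : TangentSpace (𝓡 4) x) : Prop where
  ll : g.val x l l = 0
  nn : g.val x n n = 0
  ln : g.val x l n = 1
  la : g.val x l a = 0
  lb : g.val x l b = 0
  na : g.val x n a = 0
  nb : g.val x n b = 0
  aa : g.val x a a = -1
  bb : g.val x b b = -1
  ab : g.val x a b = 0

variable {l n a b : TangentSpace (𝓡 4) x}

lemma inv_sqrt_two_mul_self : (√2)⁻¹ * (√2)⁻¹ = (1 / 2 : ℝ) := by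
  rw [← mul_inv, Real.mul_self_sqrt (by norm_num), one_div]

lemma IsRealTetrad.isOrthonormal (h : IsRealTetrad g x l n a b) :
    g.IsOrthonormal ![(√2)⁻¹ • (l + n), (√2)⁻¹ • (l - n), a, b] := by
  have hs := inv_sqrt_two_mul_self
  have nl := g.symm x n l ▸ h.ln
  have al := g.symm x a l ▸ h.la
  have bl := g.symm x b l ▸ h.lb
  have an := g.symm x a n ▸ h.na
  have bn := g.symm x b n ▸ h.nb
  have ba := g.symm x b a ▸ h.ab
  intro i j
  fin_cases i <;> fin_cases j <;>
    simp [sgn, h.ll, h.nn, h.ln, h.la, h.lb, h.na, h.nb, h.aa, h.bb, h.ab, nl, al, bl, an, bn, ba]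
  all_goals linarith

lemma IsRealTetrad.eq_sum (h : IsRealTetrad g x l n a b) (v : TangentSpace (𝓡 4) x) :
    v = g.val x v n • l + g.val x v l • n - g.val x v a • a - g.val x v b • b := by
  have hs := inv_sqrt_two_mul_self
  have := h.isOrthonormal.eq_sum v
  rw [Fin.sum_univ_four] at this
  conv_lhs => rw [this]
  simp only [sgn, Matrix.cons_val, map_add, map_sub, map_smul, smul_eq_mul, smul_smul, smul_add,
    smul_sub, Fin.isValue, if_true, Fin.reduceEq, if_false]
  match_scalars
  · linear_combination (2 * g.val x v n) * hs
  · linear_combination (2 * g.val x v l) * hs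
  · ring
  · ring

lemma IsRealTetrad.sum_val_eq (h : IsRealTetrad g x l n a b)
    (R : TangentSpace (𝓡 4) x →ₗ[ℝ] TangentSpace (𝓡 4) x) :
    ∑ i, sgn i * g.val x (R (g.frame x i)) (g.frame x i) =
      g.val x (R l) n + g.val x (R n) l - g.val x (R a) a - g.val x (R b) b := by
  have hs := inv_sqrt_two_mul_self
  rw [(g.isOrthonormal_frame x).sum_val_eq h.isOrthonormal, sum_sgn]
  simp only [Matrix.cons_val, map_add, map_sub, map_smul, smul_eq_mul, Fin.isValue, add_apply,
    sub_apply, smul_apply]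
  linear_combination (2 * (g.val x (R l) n + g.val x (R n) l)) * hs

/-- A nonzero vector is orthogonal to any three given vectors. -/
lemma LorentzMetric.exists_ne_zero_orthogonal (u v w : TangentSpace (𝓡 4) x) :
    ∃ z, z ≠ 0 ∧ g.val x u z = 0 ∧ g.val x v z = 0 ∧ g.val x w z = 0 := by
  let L : TangentSpace (𝓡 4) x →ₗ[ℝ] (Fin 3 → ℝ) :=
    LinearMap.pi ![(g.val x u).toLinearMap, (g.val x v).toLinearMap, (g.val x w).toLinearMap]
  have hL : LinearMap.ker L ≠ ⊥ := LinearMap.ker_ne_bot_of_finrank_lt (by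
    simp [finrank_tangentSpace])
  obtain ⟨z, hz, hz0⟩ := (Submodule.ne_bot_iff _).1 hL
  have hz' := LinearMap.mem_ker.1 hz
  refine ⟨z, hz0, ?_, ?_, ?_⟩
  · simpa [L] using congrFun hz' 0
  · simpa [L] using congrFun hz' 1
  · simpa [L] using congrFun hz' 2

/-- Every nonzero null vector is part of a real null tetrad. -/
lemma TimeOrientation.exists_isRealTetrad (t : TimeOrientation g) (hl0 : l ≠ 0)
    (hl : g.val x l l = 0) : ∃ n a b, IsRealTetrad g x l n a b := by
  have ht := t.timelike x
  set τ := t.field x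
  have hlt : g.val x l τ ≠ 0 := fun h ↦
    hl0 (g.eq_zero_of_timelike ht (by rw [g.symm, h]) hl.ge)
  set c := g.val x l τ with hc
  -- The factor `c⁻¹` normalises `l·n`; the multiple of `l` leaves this product unchanged and is
  -- chosen to cancel the norm of `c⁻¹ τ`.
  set n := c⁻¹ • τ - (g.val x τ τ / (2 * c ^ 2)) • l with hn
  have hln : g.val x l n = 1 := by
    simp [hn, hl, ← hc, hlt]
  have hnn : g.val x n n = 0 := by
    simp only [hn, map_sub, map_smul, sub_apply, smul_apply, smul_eq_mul, hl, g.symm x τ l, ← hc]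
    field_simp
    ring
  -- As `l + n` is timelike, the metric is negative definite on the vectors orthogonal to both `l`
  -- and `n`, so `a` and `b` can be found there and normalised.
  have hpos : 0 < g.val x (l + n) (l + n) := by
    simp only [map_add, add_apply, hl, hnn, hln, g.symm x n l]
    norm_num
  have hneg {z : TangentSpace (𝓡 4) x} (hz : z ≠ 0) (h1 : g.val x l z = 0)
      (h2 : g.val x n z = 0) : g.val x z z < 0 := by
    by_contra! h
    exact hz (g.eq_zero_of_timelike hpos (by simp [h1, h2]) h)
  have hunit {z : TangentSpace (𝓡 4) x} (h : g.val x z z < 0) :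
      g.val x ((√(-g.val x z z))⁻¹ • z) ((√(-g.val x z z))⁻¹ • z) = -1 := by
    have h1 : √(-g.val x z z) * √(-g.val x z z) = -g.val x z z :=
      Real.mul_self_sqrt (by linarith)
    have h2 : √(-g.val x z z) ≠ 0 := (Real.sqrt_pos.2 (by linarith)).ne'
    simp only [map_smul, smul_apply, smul_eq_mul]
    field_simp
    linarith
  obtain ⟨a, ha0, hla, hna, -⟩ := g.exists_ne_zero_orthogonal l n n
  obtain ⟨b, hb0, hlb, hnb, hab⟩ := g.exists_ne_zero_orthogonal l n a
  exact ⟨n, (√(-g.val x a a))⁻¹ • a, (√(-g.val x b b))⁻¹ • b, hl, hnn, hln, by simp [hla],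
    by simp [hlb], by simp [hna], by simp [hnb], hunit (hneg ha0 hla hna),
    hunit (hneg hb0 hlb hnb), by simp [hab]⟩

lemma TimeOrientation.val_ne_zero (t : TimeOrientation g) (hl0 : l ≠ 0)
    (hl : g.val x l l = 0) : g.val x l (t.field x) ≠ 0 := fun h ↦
  hl0 (g.eq_zero_of_timelike (t.timelike x) (by rw [g.symm, h]) hl.ge)

/-- Vectors orthogonal to the orthogonal complement of the null vector `l` are multiples of `l`. -/
lemma IsRealTetrad.eq_smul (h : IsRealTetrad g x l n a b) {v : TangentSpace (𝓡 4) x}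
    (hv : ∀ w, g.val x l w = 0 → g.val x v w = 0) : v = g.val x v n • l := by
  conv_lhs => rw [h.eq_sum v]
  simp [hv l h.ll, hv a h.la, hv b h.lb]

lemma IsRealTetrad.isNullTetrad (h : IsRealTetrad g x l n a b) :
    IsNullTetrad g x l n ⟨(√2)⁻¹ • a, (√2)⁻¹ • b⟩ := by
  have hs := inv_sqrt_two_mul_self
  have ba := g.symm x b a ▸ h.ab
  refine ⟨h.ll, h.nn, h.ln, ?_, ?_, ?_, ?_⟩ <;>
    simp [gC, CVec.ofReal, CVec.conj, h.la, h.lb, h.na, h.nb, h.aa, h.bb, h.ab, ba, Complex.ext_iff]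
  linarith

lemma IsNullTetrad.val_re_im {m : CVec (TangentSpace (𝓡 4) x)} (h : IsNullTetrad g x l n m) :
    g.val x l m.re = 0 ∧ g.val x l m.im = 0 ∧ g.val x n m.re = 0 ∧ g.val x n m.im = 0 ∧
    g.val x m.re m.re = -1 / 2 ∧ g.val x m.im m.im = -1 / 2 ∧ g.val x m.re m.im = 0 := by
  have h1 := h.lm
  have h2 := h.nm
  have h3 := h.mm
  have h4 := h.mmbar
  simp [gC, CVec.ofReal, CVec.conj, Complex.ext_iff, g.symm x m.im m.re] at h1 h2 h3 h4
  exact ⟨h1.1, h1.2, h2.1, h2.2, by linarith, by linarith, by linarith⟩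

lemma IsNullTetrad.isRealTetrad {m : CVec (TangentSpace (𝓡 4) x)} (h : IsNullTetrad g x l n m) :
    IsRealTetrad g x l n (√2 • m.re) (√2 • m.im) := by
  have hs : √2 * √2 = (2 : ℝ) := Real.mul_self_sqrt (by norm_num)
  obtain ⟨h1, h2, h3, h4, h5, h6, h7⟩ := h.val_re_im
  refine ⟨h.ll, h.nn, h.ln, ?_, ?_, ?_, ?_, ?_, ?_, ?_⟩ <;> simp [h1, h2, h3, h4, h5, h6, h7] <;>
  linarith

/-- The vector metrically dual to a covector. -/
def LorentzMetric.sharp (g : LorentzMetric M) {x : M} (α : TangentSpace (𝓡 4) x →L[ℝ] ℝ) :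
    TangentSpace (𝓡 4) x :=
  ∑ i, (sgn i * α (g.frame x i)) • g.frame x i

lemma LorentzMetric.val_sharp (g : LorentzMetric M) (α : TangentSpace (𝓡 4) x →L[ℝ] ℝ)
    (w : TangentSpace (𝓡 4) x) : g.val x (g.sharp α) w = α w := by
  conv_rhs => rw [(g.isOrthonormal_frame x).eq_sum w]
  simp only [sharp, map_sum, map_smul, sum_apply, smul_apply, smul_eq_mul]
  exact Finset.sum_congr rfl fun i _ ↦ by rw [g.symm x w]; ring

end LorentzAlgebra

/-! ### Smoothness of metric duals and of 1-forms -/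

section Sharp

variable {M : Type*} [TopologicalSpace M] [ChartedSpace E4 M] [IsManifold (𝓡 4) ∞ M]

lemma IsSmoothFun.det {ι : Type*} [Fintype ι] [DecidableEq ι] {A : M → Matrix ι ι ℝ}
    (hA : ∀ i j, IsSmoothFun fun x ↦ A x i j) : IsSmoothFun fun x ↦ (A x).det := by
  unfold IsSmoothFun
  simp only [Matrix.det_apply']
  exact contMDiff_finsetSum fun σ _ ↦ contMDiff_const.mul (contMDiff_finsetProd fun i _ ↦ hA _ _)

/-- The metric dual of a smooth 1-form is a smooth vector field. -/
lemma IsSmoothVec.sharp [T2Space M] (g : LorentzMetric M) {α : Π x : M, TangentSpace (𝓡 4) x →L[ℝ] ℝ}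
    (hα : ∀ X, IsSmoothVec X → IsSmoothFun fun x ↦ α x (X x)) :
    IsSmoothVec fun x ↦ g.sharp (α x) := by
  intro p
  -- The pointwise chosen frame in the definition of `sharp` need not vary smoothly. The dual vector
  -- is therefore recomputed by Cramer's rule from the Gram matrix of smooth fields `s i` which form
  -- an orthonormal frame at `p` only; they stay independent as long as the Gram determinant is
  -- nonzero.
  choose s hs hsp using fun i ↦ exists_isSmoothVec_apply_eq (g.frame p i)
  let G : M → Matrix (Fin 4) (Fin 4) ℝ := fun x ↦ Matrix.of fun i j ↦ g.val x (s i x) (s j x)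
  have hG (i j) : IsSmoothFun fun x ↦ G x i j := IsSmoothFun.metric g (hs i) (hs j)
  have hdet : IsSmoothFun fun x ↦ (G x).det := IsSmoothFun.det hG
  let c : Fin 4 → M → ℝ := fun i x ↦ (G x).cramer (fun j ↦ α x (s j x)) i
  have hc (i) : IsSmoothFun (c i) := by
    simp only [c, Matrix.cramer_apply]
    refine IsSmoothFun.det fun j k ↦ ?_
    by_cases h : k = i
    · subst h
      simpa using hα _ (hs j)
    · simpa [Matrix.updateCol_ne h] using hG j k
  have hsum : IsSmoothVec (∑ i, c i • s i) := IsSmoothVec.sum fun i ↦ (hs i).smul (hc i)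
  have hp : (G p).det ≠ 0 := by
    have : G p = Matrix.diagonal sgn := by
      ext i j
      simp [G, hsp, g.isOrthonormal_frame p i j, Matrix.diagonal_apply]
    rw [this, Matrix.det_diagonal]
    exact Finset.prod_ne_zero_iff.2 fun i _ ↦ left_ne_zero_of_mul_eq_one (sgn_mul_self i)
  have key : ∀ᶠ x in 𝓝 p,
      g.sharp (α x) = ((fun x ↦ ((G x).det)⁻¹) • (∑ i, c i • s i)) x := by
    filter_upwards [(ContMDiff.continuous hdet).continuousAt.eventually_ne hp] with x hx
    rw [Pi.smul_apply', eq_inv_smul_iff₀ hx]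
    have hli : LinearIndependent ℝ fun i ↦ s i x := by
      refine Fintype.linearIndependent_iff.2 fun d hd ↦ congrFun
        (Matrix.eq_zero_of_mulVec_eq_zero hx (funext fun j ↦ ?_))
      have := congrArg (g.val x (s j x)) hd
      simpa [Matrix.mulVec, dotProduct, G, mul_comm] using this
    let b := basisOfLinearIndependentOfCardEqFinrank hli (by simp [finrank_tangentSpace])
    refine g.eq_of_forall fun w ↦ ?_
    have : (g.val x ((G x).det • g.sharp (α x))).toLinearMap =
        (g.val x ((∑ i, c i • s i) x)).toLinearMap := by
      refine b.ext fun j ↦ ?_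
      have hcr := congrFun (Matrix.mulVec_cramer (G x) (fun j ↦ α x (s j x))) j
      simp only [b, coe_basisOfLinearIndependentOfCardEqFinrank, ContinuousLinearMap.coe_coe,
        map_smul, smul_apply, g.val_sharp, Finset.sum_apply, Pi.smul_apply', map_sum, sum_apply]
      rw [Pi.smul_apply] at hcr
      rw [← hcr]
      simp only [Matrix.mulVec, dotProduct, G, Matrix.of_apply, smul_eq_mul]
      exact Finset.sum_congr rfl fun i _ ↦ by rw [g.symm x (s j x)]; ring
    exact LinearMap.congr_fun this w
  have hinv : ContMDiffAt (𝓡 4) 𝓘(ℝ, ℝ) ∞ (fun x ↦ ((G x).det)⁻¹) p :=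
    (hdet p).inv₀ hp
  refine (hinv.smul_section (hsum p)).congr_of_eventuallyEq ?_
  filter_upwards [key] with x hx
  rw [hx]

/-- A 1-form is a smooth section as soon as its values on smooth vector fields are smooth. -/
lemma contMDiff_of_isSmoothFun_apply [T2Space M] (g : LorentzMetric M)
    {α : Π x : M, TangentSpace (𝓡 4) x →L[ℝ] ℝ}
    (hα : ∀ X, IsSmoothVec X → IsSmoothFun fun x ↦ α x (X x)) :
    ContMDiff (𝓡 4) ((𝓡 4).prod 𝓘(ℝ, E4 →L[ℝ] ℝ)) ∞
      (fun x ↦ Bundle.TotalSpace.mk' (E4 →L[ℝ] ℝ)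
        (E := fun x : M ↦ TangentSpace (𝓡 4) x →L[ℝ] ℝ) x (α x)) := by
  have h : ∀ x, α x = g.val x (g.sharp (α x)) := fun x ↦ by ext w; rw [g.val_sharp]
  have := ContMDiff.clm_bundle_apply (F₂ := E4 →L[ℝ] ℝ)
    (E₂ := fun x : M ↦ TangentSpace (𝓡 4) x →L[ℝ] ℝ) g.smooth (IsSmoothVec.sharp g hα)
  simpa only [← h] using this

end Sharp

/-! ### Tensoriality and symmetries of the Riemann tensor -/

section Curvature

variable {M : Type*} [TopologicalSpace M] [ChartedSpace E4 M] [IsManifold (𝓡 4) ∞ M]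

/-- Near a point, a smooth field is a combination of smooth fields; the coefficients vanish where
the field does. -/
lemma IsSmoothVec.exists_eventually_eq_sum [T2Space M] {X : Π x : M, TangentSpace (𝓡 4) x}
    (hX : IsSmoothVec X) (p : M) :
    ∃ (F : Fin 4 → M → ℝ) (E : Fin 4 → Π x : M, TangentSpace (𝓡 4) x),
      (∀ i, IsSmoothFun (F i)) ∧ (∀ i, IsSmoothVec (E i)) ∧
      (∀ᶠ x in 𝓝 p, X x = (∑ i, F i • E i) x) ∧ (X p = 0 → ∀ i, F i p = 0) := by
  have : IsManifold (𝓡 4) (∞ + 1) M := by simpa using (inferInstance : IsManifold (𝓡 4) ∞ M)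
  let e := trivializationAt E4 (TangentSpace (𝓡 4) : M → Type _) p
  let b := (EuclideanSpace.basisFun (Fin 4) ℝ).toBasis
  have hpe : p ∈ e.baseSet := FiberBundle.mem_baseSet_trivializationAt' p
  choose F hF hF' using fun i ↦ exists_isSmoothFun_eventuallyEq e.open_baseSet hpe
    (contMDiffOn_localFrameCoeff (k := ∞) b e.open_baseSet subset_rfl (ContMDiff.contMDiffOn hX) i)
  choose E hE hE' using fun i ↦ exists_isSmoothVec_eventuallyEq e.open_baseSet hpe
    (e.contMDiffOn_localFrame_baseSet (I := 𝓡 4) ∞ b i)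
  refine ⟨F, E, hF, hE, ?_, fun h i ↦ ?_⟩
  · filter_upwards [e.eventually_eq_localFrame_sum_coeff_smul (I := 𝓡 4) (s := X) b hpe,
      Filter.eventually_all.2 hF', Filter.eventually_all.2 hE'] with x hx h1 h2
    rw [hx]
    simp [h1, h2, LinearMap.piApply]
  · rw [(hF' i).self_of_nhds]
    simp [LinearMap.piApply, h]

/-- An operation on smooth fields that is linear over the smooth functions depends only on the
value of the field at the point. -/
lemma eq_of_apply_eq_of_linear [T2Space M] {A : Type*} [AddCommGroup A] [Module ℝ A]
    (Φ : (Π x : M, TangentSpace (𝓡 4) x) → A) {p : M}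
    (hadd : ∀ X Y, IsSmoothVec X → IsSmoothVec Y → Φ (X + Y) = Φ X + Φ Y)
    (hsmul : ∀ (f : M → ℝ) X, IsSmoothFun f → IsSmoothVec X → Φ (f • X) = f p • Φ X)
    {X Y : Π x : M, TangentSpace (𝓡 4) x} (hX : IsSmoothVec X) (hY : IsSmoothVec Y)
    (hXY : X p = Y p) : Φ X = Φ Y := by
  have hsum {F : Fin 4 → M → ℝ} {E : Fin 4 → Π x : M, TangentSpace (𝓡 4) x}
      (hF : ∀ i, IsSmoothFun (F i)) (hE : ∀ i, IsSmoothVec (E i)) :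
      Φ (∑ i, F i • E i) = ∑ i, F i p • Φ (E i) := by
    simp only [Fin.sum_univ_four]
    have h i := (hE i).smul (hF i)
    rw [hadd _ _ (((h 0).add (h 1)).add (h 2)) (h 3), hadd _ _ ((h 0).add (h 1)) (h 2),
      hadd _ _ (h 0) (h 1), hsmul _ _ (hF 0) (hE 0), hsmul _ _ (hF 1) (hE 1),
      hsmul _ _ (hF 2) (hE 2), hsmul _ _ (hF 3) (hE 3)]
  have hzero {W : Π x : M, TangentSpace (𝓡 4) x} (hW : IsSmoothVec W) (h0 : W p = 0) :
      Φ W = 0 := by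
    obtain ⟨F, E, hF, hE, hWE, hF0⟩ := hW.exists_eventually_eq_sum p
    obtain ⟨χ, hχ, hχp, hχ0⟩ := exists_cutoff hWE
    -- The expansion of `W` holds only near `p`; after multiplication by the cutoff it holds
    -- everywhere, and `χ p = 1` makes the cutoff invisible to `Φ`.
    have : χ • W = χ • ∑ i, F i • E i := by
      ext1 x
      by_cases hx : W x = (∑ i, F i • E i) x
      · rw [Pi.smul_apply', Pi.smul_apply', hx]
      · rw [Pi.smul_apply', Pi.smul_apply', hχ0 x hx, zero_smul, zero_smul]
    have h1 := hsmul χ W hχ hW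
    rw [this, hsmul _ _ hχ (IsSmoothVec.sum fun i ↦ (hE i).smul (hF i)), hχp, hsum hF hE] at h1
    simpa [hF0 h0] using h1.symm
  have h := hadd (X - Y) Y (hX.sub hY) hY
  rwa [sub_add_cancel, hzero (hX.sub hY) (by simp [hXY]), zero_add] at h

variable {g : LorentzMetric M} {cov : Connection M} (hcov : IsLeviCivita g cov)
  {X Y Z : Π x : M, TangentSpace (𝓡 4) x}

include hcov

lemma riemannFields_congr (hX : IsSmoothVec X) (hY : IsSmoothVec Y) (hZ : IsSmoothVec Z)
    {X' Y' Z' : Π x : M, TangentSpace (𝓡 4) x} {p : M} (hX' : ∀ᶠ x in 𝓝 p, X x = X' x)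
    (hY' : ∀ᶠ x in 𝓝 p, Y x = Y' x) (hZ' : ∀ᶠ x in 𝓝 p, Z x = Z' x) :
    riemannFields cov X' Y' Z' p = riemannFields cov X Y Z p := by
  have hZc : ∀ᶠ x in 𝓝 p, cov Z' x = cov Z x := by
    filter_upwards [hZ'.eventually_nhds] with x hx
    exact Connection.congr cov (hZ.mdifferentiableAt x) (hx.mono fun _ h ↦ h.symm)
  have h1 : cov (fun y ↦ cov Z' y (Y' y)) p = cov (fun y ↦ cov Z y (Y y)) p := by
    refine Connection.congr cov ((hY.cov hcov hZ).mdifferentiableAt p) ?_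
    filter_upwards [hZc, hY'] with x h1 h2
    rw [h1, h2]
  have h2 : cov (fun y ↦ cov Z' y (X' y)) p = cov (fun y ↦ cov Z y (X y)) p := by
    refine Connection.congr cov ((hX.cov hcov hZ).mdifferentiableAt p) ?_
    filter_upwards [hZc, hX'] with x h1 h2
    rw [h1, h2]
  have h3 : VectorField.mlieBracket (𝓡 4) X' Y' p = VectorField.mlieBracket (𝓡 4) X Y p :=
    Filter.EventuallyEq.mlieBracket_vectorField_eq (hX'.mono fun _ h ↦ h.symm)
      (hY'.mono fun _ h ↦ h.symm)
  simp only [riemannFields, h1, h2, h3, hZc.self_of_nhds, hX'.self_of_nhds, hY'.self_of_nhds]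

omit hcov in
lemma riemannFields_swap (X Y Z : Π x : M, TangentSpace (𝓡 4) x) (p : M) :
    riemannFields cov X Y Z p = -riemannFields cov Y X Z p := by
  simp only [riemannFields]
  rw [VectorField.mlieBracket_swap_apply, map_neg]
  abel

lemma riemannFields_add_left {X' : Π x : M, TangentSpace (𝓡 4) x} (hX : IsSmoothVec X)
    (hX' : IsSmoothVec X') (hZ : IsSmoothVec Z) (p : M) :
    riemannFields cov (X + X') Y Z p = riemannFields cov X Y Z p + riemannFields cov X' Y Z p := by
  have h : (fun y ↦ cov Z y ((X + X') y)) =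
      (fun y ↦ cov Z y (X y)) + fun y ↦ cov Z y (X' y) := by
    ext1 y; simp
  simp only [riemannFields, h]
  rw [VectorField.mlieBracket_add_left (hX.mdifferentiableAt p) (hX'.mdifferentiableAt p),
    Connection.apply_add cov (hX.cov hcov hZ) (hX'.cov hcov hZ)]
  simp only [Pi.add_apply, map_add, add_apply]
  abel

lemma riemannFields_smul_left {f : M → ℝ} (hf : IsSmoothFun f) (hX : IsSmoothVec X)
    (hZ : IsSmoothVec Z) (p : M) :
    riemannFields cov (f • X) Y Z p = f p • riemannFields cov X Y Z p := by
  have h : (fun y ↦ cov Z y ((f • X) y)) = f • fun y ↦ cov Z y (X y) := by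
    ext1 y; simp
  simp only [riemannFields, h]
  rw [VectorField.mlieBracket_smul_left (hf.mdifferentiableAt p) (hX.mdifferentiableAt p),
    Connection.apply_smul cov hf (hX.cov hcov hZ)]
  simp only [Pi.smul_apply', map_add, map_smul]
  module

lemma riemannFields_add_right {Z' : Π x : M, TangentSpace (𝓡 4) x} (hX : IsSmoothVec X)
    (hY : IsSmoothVec Y) (hZ : IsSmoothVec Z) (hZ' : IsSmoothVec Z') (p : M) :
    riemannFields cov X Y (Z + Z') p = riemannFields cov X Y Z p + riemannFields cov X Y Z' p := by
  have h (W : Π x : M, TangentSpace (𝓡 4) x) : (fun y ↦ cov (Z + Z') y (W y)) =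
      (fun y ↦ cov Z y (W y)) + fun y ↦ cov Z' y (W y) := by
    ext1 y; simp [Connection.apply_add cov hZ hZ']
  simp only [riemannFields]
  rw [h X, h Y, Connection.apply_add cov hZ hZ', Connection.apply_add cov (hX.cov hcov hZ) (hX.cov hcov hZ'),
    Connection.apply_add cov (hY.cov hcov hZ) (hY.cov hcov hZ')]
  simp only [add_apply]
  abel

/-- The first derivatives of `f` cancel between the two iterated covariant derivatives, and the
second derivatives `X(Y f) - Y(X f)` are absorbed by the bracket term through
`mvfderiv_mlieBracket`. -/
lemma riemannFields_smul_right [T2Space M] (t : TimeOrientation g) {f : M → ℝ}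
    (hf : IsSmoothFun f) (hX : IsSmoothVec X) (hY : IsSmoothVec Y) (hZ : IsSmoothVec Z) (p : M) :
    riemannFields cov X Y (f • Z) p = f p • riemannFields cov X Y Z p := by
  have h (W : Π x : M, TangentSpace (𝓡 4) x) : (fun y ↦ cov (f • Z) y (W y)) =
      (f • fun y ↦ cov Z y (W y)) + (fun y ↦ mvfderiv (𝓡 4) f y (W y)) • Z := by
    ext1 y
    simp [Connection.apply_smul cov hf hZ]
  have hXf := hf.mvfderiv t hcov hX
  have hYf := hf.mvfderiv t hcov hY
  simp only [riemannFields]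
  rw [h X, h Y, Connection.apply_smul cov hf hZ, Connection.apply_add cov ((hX.cov hcov hZ).smul hf) (hZ.smul hXf),
    Connection.apply_add cov ((hY.cov hcov hZ).smul hf) (hZ.smul hYf)]
  simp only [add_apply]
  rw [Connection.apply_smul cov hf (hX.cov hcov hZ), Connection.apply_smul cov hf (hY.cov hcov hZ),
    Connection.apply_smul cov hXf hZ, Connection.apply_smul cov hYf hZ,
    mvfderiv_mlieBracket hf hX hY hXf hYf]
  module

/-- The Riemann tensor can be computed with arbitrary smooth fields. -/
lemma riemann_apply [T2Space M] (t : TimeOrientation g) (hX : IsSmoothVec X) (hY : IsSmoothVec Y)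
    (hZ : IsSmoothVec Z) (p : M) :
    riemann cov p (X p) (Y p) (Z p) = riemannFields cov X Y Z p := by
  obtain ⟨X', hX', h1⟩ := exists_isSmoothVec_extend (X p)
  obtain ⟨Y', hY', h2⟩ := exists_isSmoothVec_extend (Y p)
  obtain ⟨Z', hZ', h3⟩ := exists_isSmoothVec_extend (Z p)
  have e1 : X' p = X p := by simpa using h1.self_of_nhds
  have e2 : Y' p = Y p := by simpa using h2.self_of_nhds
  have e3 : Z' p = Z p := by simpa using h3.self_of_nhds
  -- Tensoriality in the second argument follows from that in the first by antisymmetry; the third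
  -- argument is treated separately.
  have slot1 {X X' Y Z : Π x : M, TangentSpace (𝓡 4) x} (hX : IsSmoothVec X)
      (hX' : IsSmoothVec X') (hZ : IsSmoothVec Z) (h : X' p = X p) :
      riemannFields cov X' Y Z p = riemannFields cov X Y Z p :=
    eq_of_apply_eq_of_linear (fun W ↦ riemannFields cov W Y Z p)
      (fun _ _ hV hW ↦ riemannFields_add_left hcov hV hW hZ p)
      (fun _ _ hf hW ↦ riemannFields_smul_left hcov hf hW hZ p) hX' hX h
  rw [riemann, riemannFields_congr hcov hX' hY' hZ' h1 h2 h3, slot1 hX hX' hZ' e1,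
    riemannFields_swap, slot1 hY hY' hZ' e2, ← riemannFields_swap]
  exact eq_of_apply_eq_of_linear (fun W ↦ riemannFields cov X Y W p)
    (fun _ _ hV hW ↦ riemannFields_add_right hcov hX hY hV hW p)
    (fun _ _ hf hW ↦ riemannFields_smul_right hcov t hf hX hY hW p) hZ' hZ e3

/-- `R(u,v)w` as a linear function of `u`. -/
lemma exists_linearMap_riemann [T2Space M] (t : TimeOrientation g) {p : M}
    (v w : TangentSpace (𝓡 4) p) :
    ∃ R : TangentSpace (𝓡 4) p →ₗ[ℝ] TangentSpace (𝓡 4) p, ∀ u, R u = riemann cov p u v w := by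
  obtain ⟨Y, hY, rfl⟩ := exists_isSmoothVec_apply_eq v
  obtain ⟨Z, hZ, rfl⟩ := exists_isSmoothVec_apply_eq w
  refine ⟨⟨⟨fun u ↦ riemann cov p u (Y p) (Z p), fun u u' ↦ ?_⟩, fun c u ↦ ?_⟩, fun u ↦ rfl⟩
  · obtain ⟨X, hX, rfl⟩ := exists_isSmoothVec_apply_eq u
    obtain ⟨X', hX', rfl⟩ := exists_isSmoothVec_apply_eq u'
    rw [← Pi.add_apply, riemann_apply hcov t (hX.add hX') hY hZ, riemann_apply hcov t hX hY hZ,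
      riemann_apply hcov t hX' hY hZ, riemannFields_add_left hcov hX hX' hZ]
  · obtain ⟨X, hX, rfl⟩ := exists_isSmoothVec_apply_eq u
    have hc : IsSmoothFun fun _ : M ↦ c := isSmoothFun_const c
    have h := riemannFields_smul_left (Y := Y) hcov hc hX hZ p
    rw [← riemann_apply hcov t hX hY hZ, ← riemann_apply hcov t (hX.smul hc) hY hZ] at h
    exact h

lemma riemann_self [T2Space M] (t : TimeOrientation g) {p : M} (u w : TangentSpace (𝓡 4) p) :
    riemann cov p u u w = 0 := by
  obtain ⟨X, hX, rfl⟩ := exists_isSmoothVec_apply_eq u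
  obtain ⟨Z, hZ, rfl⟩ := exists_isSmoothVec_apply_eq w
  rw [riemann_apply hcov t hX hX hZ]
  simp [riemannFields]

/-- By metricity this is the commutator identity `[X,Y]f = X(Y f) - Y(X f)` for the function `f =
g(Z,Z)`. -/
lemma val_riemann_self [T2Space M] (t : TimeOrientation g) {p : M}
    (u v w : TangentSpace (𝓡 4) p) : g.val p (riemann cov p u v w) w = 0 := by
  obtain ⟨X, hX, rfl⟩ := exists_isSmoothVec_apply_eq u
  obtain ⟨Y, hY, rfl⟩ := exists_isSmoothVec_apply_eq v
  obtain ⟨Z, hZ, rfl⟩ := exists_isSmoothVec_apply_eq w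
  have hn : IsSmoothFun fun x ↦ g.val x (Z x) (Z x) := IsSmoothFun.metric g hZ hZ
  have hd (x : M) (v : TangentSpace (𝓡 4) x) :
      mvfderiv (𝓡 4) (fun x ↦ g.val x (Z x) (Z x)) x v = 2 * g.val x (cov Z x v) (Z x) := by
    rw [hcov.mvfderiv_metric hZ hZ, g.symm x (Z x)]
    ring
  have hdd {V : Π x : M, TangentSpace (𝓡 4) x} (hV : IsSmoothVec V) (v : TangentSpace (𝓡 4) p) :
      mvfderiv (𝓡 4) (fun x ↦ 2 * g.val x (cov Z x (V x)) (Z x)) p v =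
        2 * (g.val p (cov (fun y ↦ cov Z y (V y)) p v) (Z p) +
          g.val p (cov Z p (V p)) (cov Z p v)) := by
    rw [mvfderiv_fun_mul mdifferentiableAt_const
      ((IsSmoothFun.metric g (hV.cov hcov hZ) hZ).mdifferentiableAt p)]
    simp only [add_apply, smul_apply, mvfderiv_const, smul_eq_mul,
      hcov.mvfderiv_metric (hV.cov hcov hZ) hZ]
    simp
  have h := mvfderiv_mlieBracket hn hX hY (hn.mvfderiv t hcov hX) (hn.mvfderiv t hcov hY) p
  simp only [hd, hdd hX, hdd hY] at h
  rw [riemann_apply hcov t hX hY hZ]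
  simp only [riemannFields, map_sub, sub_apply]
  rw [g.symm p (cov Z p (Y p))] at h
  linarith

/-- `Ric(l,l)` in a null tetrad. -/
lemma IsRealTetrad.ricci_eq [T2Space M] (t : TimeOrientation g) {p : M}
    {l n a b : TangentSpace (𝓡 4) p} (h : IsRealTetrad g p l n a b) :
    ricci g cov p l l =
      -g.val p (riemann cov p a l l) a - g.val p (riemann cov p b l l) b := by
  obtain ⟨R, hR⟩ := exists_linearMap_riemann hcov t l l
  -- In the trace over the tetrad both terms that pair `l` with `n` vanish, as `R(l,l)l = 0` and
  -- `g(R(n,l)l,l) = 0`.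
  have := h.sum_val_eq R
  simp only [hR, riemann_self hcov t, val_riemann_self hcov t] at this
  rw [ricci, this]
  simp

end Curvature

/-! ### Tangent spaces of null hypersurfaces and extension of fields -/

section Hypersurface

variable {M : Type*} [TopologicalSpace M] [ChartedSpace E4 M] [IsManifold (𝓡 4) ∞ M]

/-- The representation in the chart at `p` of a function smooth at `p` has the derivative of the
function as its strict derivative. -/
lemma hasStrictFDerivAt_extChartAt_symm {f : M → ℝ} {p : M}
    (hf : ContMDiffAt (𝓡 4) 𝓘(ℝ, ℝ) ∞ f p) :
    HasStrictFDerivAt (f ∘ (extChartAt (𝓡 4) p).symm) (mvfderiv (𝓡 4) f p : E4 →L[ℝ] ℝ)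
      (extChartAt (𝓡 4) p p) := by
  have h1 : ContDiffAt ℝ ∞ (f ∘ (extChartAt (𝓡 4) p).symm) (extChartAt (𝓡 4) p p) := by
    have := (contMDiffAt_iff.1 hf).2
    simpa [contDiffWithinAt_univ, chartAt_self_eq] using this
  have h2 : (mvfderiv (𝓡 4) f p : E4 →L[ℝ] ℝ) =
      fderiv ℝ (f ∘ (extChartAt (𝓡 4) p).symm) (extChartAt (𝓡 4) p p) := by
    rw [(hf.mdifferentiableAt (by simp)).mvfderiv]
    simp [writtenInExtChartAt, fderivWithin_univ, chartAt_self_eq]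
    rfl
  rw [h2]
  exact h1.hasStrictFDerivAt (by simp)

/-- If `f` vanishes on the zero set of `u`, the derivative of `f` is a multiple of that of `u`. -/
lemma exists_eq_smul_of_hasStrictFDerivAt {E : Type*} [NormedAddCommGroup E] [NormedSpace ℝ E]
    [CompleteSpace E] {u f : E → ℝ} {u' f' : StrongDual ℝ E} {z : E}
    (hu : HasStrictFDerivAt u u' z) (hf : HasStrictFDerivAt f f' z) (hu' : u' ≠ 0) (huz : u z = 0)
    (h : ∀ᶠ y in 𝓝 z, u y = 0 → f y = 0) : ∃ c : ℝ, f' = c • u' := by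
  -- On the level set of `u` the function `f` is constant near `z`, so `z` is trivially a
  -- constrained extremum and Lagrange multipliers apply; `u' ≠ 0` ensures that the multiplier of
  -- `f'` is nonzero.
  have hext : IsLocalExtrOn f {y | u y = u z} z := by
    left
    filter_upwards [self_mem_nhdsWithin, nhdsWithin_le_nhds h] with y h1 h2
    rw [h2 (h1.trans huz), h.self_of_nhds huz]
  obtain ⟨a, b, hab, h0⟩ := hext.exists_multipliers_of_hasStrictFDerivAt_1d hu hf
  have hb : b ≠ 0 := by
    rintro rfl
    rw [zero_smul, add_zero] at h0
    rcases smul_eq_zero.1 h0 with h0 | h0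
    · exact hab (by simp [h0])
    · exact hu' h0
  refine ⟨-(a / b), ?_⟩
  rw [← inv_smul_smul₀ hb f', eq_neg_of_add_eq_zero_right h0, smul_neg, smul_smul, inv_mul_eq_div]
  exact (neg_smul _ _).symm

/-- The differential of a function vanishing on the zero set of `u` is a multiple of that of `u`. -/
lemma exists_mvfderiv_eq_smul {S U V : Set M} {u f : M → ℝ} {p : M} (hp : p ∈ S) (hU : IsOpen U)
    (hpU : p ∈ U) (hu : ContMDiffOn (𝓡 4) 𝓘(ℝ, ℝ) ∞ u U) (hu0 : mvfderiv (𝓡 4) u p ≠ 0)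
    (hS : S ∩ U = {x ∈ U | u x = 0}) (hV : IsOpen V) (hpV : p ∈ V)
    (hf : ContMDiffOn (𝓡 4) 𝓘(ℝ, ℝ) ∞ f V) (hfS : ∀ x ∈ S ∩ V, f x = 0) :
    ∃ c : ℝ, mvfderiv (𝓡 4) f p = c • mvfderiv (𝓡 4) u p := by
  have hφ : (extChartAt (𝓡 4) p).symm (extChartAt (𝓡 4) p p) = p := extChartAt_to_inv p
  have hup : u p = 0 := (hS ▸ (⟨hp, hpU⟩ : p ∈ S ∩ U) : p ∈ {x ∈ U | u x = 0}).2
  refine exists_eq_smul_of_hasStrictFDerivAt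
    (hasStrictFDerivAt_extChartAt_symm (hu.contMDiffAt (hU.mem_nhds hpU)))
    (hasStrictFDerivAt_extChartAt_symm (hf.contMDiffAt (hV.mem_nhds hpV))) hu0
    (by simp only [Function.comp_apply, hφ, hup]) ?_
  have hc : Filter.Tendsto (extChartAt (𝓡 4) p).symm (𝓝 (extChartAt (𝓡 4) p p)) (𝓝 p) := by
    simpa only [ContinuousAt, extChartAt_to_inv p] using
      continuousAt_extChartAt_symm (I := 𝓡 4) p
  filter_upwards [hc (hU.mem_nhds hpU), hc (hV.mem_nhds hpV)] with z h2 h3 h4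
  have h5 : (extChartAt (𝓡 4) p).symm z ∈ S ∩ U := hS ▸ ⟨h2, h4⟩
  exact hfS _ ⟨h5.1, h3⟩

variable {g : LorentzMetric M} {S : Set M}

/-- The tangent space of a hypersurface is the orthogonal complement of any normal vector. -/
lemma IsHypersurface.mem_tangentTo_iff (hS : IsHypersurface S) {p : M} (hp : p ∈ S)
    {L : TangentSpace (𝓡 4) p} (hL0 : L ≠ 0) (hL : ∀ X ∈ tangentTo S p, g.val p L X = 0)
    {X : TangentSpace (𝓡 4) p} : X ∈ tangentTo S p ↔ g.val p L X = 0 := by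
  obtain ⟨U, u, hU, hpU, hu, hu0, hSU⟩ := hS p hp
  have hker {X : TangentSpace (𝓡 4) p} (hX : mvfderiv (𝓡 4) u p X = 0) : X ∈ tangentTo S p := by
    intro V f hV hpV hf hfS
    obtain ⟨c, hc⟩ := exists_mvfderiv_eq_smul hp hU hpU hu (hu0 p hpU) hSU hV hpV hf hfS
    simp [hc, hX]
  obtain ⟨X₀, hX₀⟩ : ∃ X₀, mvfderiv (𝓡 4) u p X₀ ≠ 0 := by
    by_contra! h
    exact hu0 p hpU (by ext v; simpa using h v)
  -- The vector `du(X₀) Y - du(Y) X₀` lies in the kernel of `du`, hence is orthogonal to `L`: the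
  -- covectors `g(L,·)` and `du` are proportional.
  have h (Y : TangentSpace (𝓡 4) p) : mvfderiv (𝓡 4) u p X₀ * g.val p L Y =
      mvfderiv (𝓡 4) u p Y * g.val p L X₀ := by
    have := hL _ (hker (X := mvfderiv (𝓡 4) u p X₀ • Y - mvfderiv (𝓡 4) u p Y • X₀) (by
      simp [mul_comm]))
    simpa [sub_eq_zero] using this
  have hLX₀ : g.val p L X₀ ≠ 0 := fun h0 ↦ hL0 (g.eq_zero_of_forall fun w ↦ by
    simpa [h0, hX₀] using h w)
  refine ⟨hL X, fun hX ↦ hker ?_⟩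
  simpa [hX, hLX₀] using h X

lemma IsNormalField.mem_tangentTo_iff (hS : IsNullHypersurface g S)
    {l : Π x : M, TangentSpace (𝓡 4) x} (hl : IsNormalField g S l) {p : M} (hp : p ∈ S)
    {X : TangentSpace (𝓡 4) p} : X ∈ tangentTo S p ↔ g.val p (l p) X = 0 :=
  hS.1.mem_tangentTo_iff hp (hl.ne_zero p hp) (hl.normal p hp)

/-- The degenerate direction `L` is tangent and also normal. Being tangent it is orthogonal to `l`,
and being normal it detects tangency, so `l` is tangent. -/
lemma IsNormalField.mem_tangentTo (hS : IsNullHypersurface g S)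
    {l : Π x : M, TangentSpace (𝓡 4) x} (hl : IsNormalField g S l) {p : M} (hp : p ∈ S) :
    l p ∈ tangentTo S p := by
  obtain ⟨L, hLT, hL0, hL⟩ := hS.2 p hp
  rw [hS.1.mem_tangentTo_iff hp hL0 hL, g.symm]
  exact hl.normal p hp L hLT

lemma IsNormalField.val_self (hS : IsNullHypersurface g S)
    {l : Π x : M, TangentSpace (𝓡 4) x} (hl : IsNormalField g S l) {p : M} (hp : p ∈ S) :
    g.val p (l p) (l p) = 0 :=
  hl.normal p hp _ (hl.mem_tangentTo hS hp)

lemma mvfderiv_eq_zero_of_mem_tangentTo {f : M → ℝ} (hf : IsSmoothFun f) {p : M}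
    (h : ∀ᶠ x in 𝓝 p, x ∈ S → f x = 0) {X : TangentSpace (𝓡 4) p} (hX : X ∈ tangentTo S p) :
    mvfderiv (𝓡 4) f p X = 0 := by
  obtain ⟨U, hU, hUo, hpU⟩ := eventually_nhds_iff.1 h
  exact hX U f hUo hpU (ContMDiff.contMDiffOn hf) fun x hx ↦ hU x hx.2 hx.1

lemma isVecExtensionAt_of_eventually {Y Z : Π x : M, TangentSpace (𝓡 4) x} {p : M}
    (hZ : IsSmoothVec Z) (h : ∀ᶠ x in 𝓝 p, x ∈ S → Z x = Y x) : IsVecExtensionAt S Y p Z := by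
  obtain ⟨U, hU, hUo, hpU⟩ := eventually_nhds_iff.1 h
  exact ⟨U, hUo, hpU, ContMDiff.contMDiffOn hZ, fun x hx ↦ hU x hx.2 hx.1⟩

lemma SmoothVecOn.exists_isSmoothVec [T2Space M] {Y : Π x : M, TangentSpace (𝓡 4) x}
    (hY : SmoothVecOn S Y) {p : M} (hp : p ∈ S) :
    ∃ Z, IsSmoothVec Z ∧ ∀ᶠ x in 𝓝 p, x ∈ S → Z x = Y x := by
  obtain ⟨Z, U, hU, hpU, hZ, h⟩ := hY p hp
  obtain ⟨Z', hZ', h'⟩ := exists_isSmoothVec_eventuallyEq hU hpU hZ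
  refine ⟨Z', hZ', ?_⟩
  filter_upwards [h', hU.mem_nhds hpU] with x h1 h2 h3
  rw [h1, h x ⟨h3, h2⟩]

lemma SmoothFunOn.exists_isSmoothFun [T2Space M] {f : M → ℝ}
    (hf : SmoothFunOn S f) {p : M} (hp : p ∈ S) :
    ∃ F, IsSmoothFun F ∧ ∀ᶠ x in 𝓝 p, x ∈ S → F x = f x := by
  obtain ⟨F, U, hU, hpU, hF, h⟩ := hf p hp
  obtain ⟨F', hF', h'⟩ := exists_isSmoothFun_eventuallyEq hU hpU hF
  refine ⟨F', hF', ?_⟩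
  filter_upwards [h', hU.mem_nhds hpU] with x h1 h2 h3
  rw [h1, h x ⟨h3, h2⟩]

/-- A vector orthogonal to `Z` extends to a smooth field orthogonal to `Z`. -/
lemma TimeOrientation.exists_isSmoothVec_orthogonal [T2Space M] (t : TimeOrientation g)
    {Z : Π x : M, TangentSpace (𝓡 4) x} (hZ : IsSmoothVec Z) {p : M}
    (hZt : g.val p (Z p) (t.field p) ≠ 0) {e : TangentSpace (𝓡 4) p} (he : g.val p (Z p) e = 0) :
    ∃ E, IsSmoothVec E ∧ E p = e ∧ ∀ x, g.val x (Z x) (E x) = 0 := by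
  obtain ⟨E, hE, rfl⟩ := exists_isSmoothVec_apply_eq e
  have ht : IsSmoothVec t.field := t.smooth
  -- This is the projection along the time orientation, multiplied by `Z·t` to avoid a division
  -- where that product vanishes. The constant factor restores the prescribed value at `p`.
  refine ⟨(fun _ ↦ (g.val p (Z p) (t.field p))⁻¹) •
    ((fun x ↦ g.val x (Z x) (t.field x)) • E - (fun x ↦ g.val x (Z x) (E x)) • t.field),
    ((hE.smul (.metric g hZ ht)).sub (ht.smul (.metric g hZ hE))).smul (isSmoothFun_const _),
    ?_, fun x ↦ ?_⟩
  · simp [he, smul_smul, hZt]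
  · simp [mul_comm]

end Hypersurface

/-! ### The second fundamental form and Raychaudhuri's equation -/

section Weingarten

lemma eq_zero_of_add_sq_eq_zero {r x y z : ℝ} (hr : 0 ≤ r)
    (h : r + x ^ 2 + y ^ 2 + 2 * z ^ 2 = 0) : x = 0 ∧ y = 0 ∧ z = 0 := by
  refine ⟨?_, ?_, ?_⟩ <;> nlinarith [sq_nonneg x, sq_nonneg y, sq_nonneg z]

variable {M : Type*} [TopologicalSpace M] [T2Space M] [ChartedSpace E4 M]
  [IsManifold (𝓡 4) ∞ M] {g : LorentzMetric M} (t : TimeOrientation g) {cov : Connection M}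
  (hcov : IsLeviCivita g cov) {S : Set M} (hS : IsNullHypersurface g S)
  {l : Π x : M, TangentSpace (𝓡 4) x} (hl : IsNormalField g S l)
  {Z : Π x : M, TangentSpace (𝓡 4) x} (hZ : IsSmoothVec Z)
  {p : M} (hp : p ∈ S) (hZl : ∀ᶠ x in 𝓝 p, x ∈ S → Z x = l x)

include hS hl hp hZl

lemma val_timeOrientation_ne_zero : g.val p (Z p) (t.field p) ≠ 0 := by
  rw [hZl.self_of_nhds hp]
  exact t.val_ne_zero (hl.ne_zero p hp) (hl.val_self hS hp)

include hcov hZ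

lemma val_cov_normal {X : TangentSpace (𝓡 4) p} (hX : X ∈ tangentTo S p) :
    g.val p (cov Z p X) (Z p) = 0 := by
  have h := mvfderiv_eq_zero_of_mem_tangentTo (IsSmoothFun.metric g hZ hZ) (S := S) (p := p) (by
    filter_upwards [hZl] with x hx hxS
    rw [hx hxS, hl.val_self hS hxS]) hX
  rw [hcov.mvfderiv_metric hZ hZ, g.symm p (Z p)] at h
  linarith

include t

/-- The second fundamental form of a null hypersurface is symmetric. -/
lemma val_cov_symm {X Y : TangentSpace (𝓡 4) p} (hX : X ∈ tangentTo S p)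
    (hY : Y ∈ tangentTo S p) : g.val p (cov Z p X) Y = g.val p (cov Z p Y) X := by
  have hZp : Z p = l p := hZl.self_of_nhds hp
  have hne := val_timeOrientation_ne_zero t hS hl hp hZl
  have hT {X : TangentSpace (𝓡 4) p} (hX : X ∈ tangentTo S p) : g.val p (Z p) X = 0 := by
    rw [hZp, ← hl.mem_tangentTo_iff hS hp]; exact hX
  obtain ⟨X, hXs, rfl, hZX⟩ := t.exists_isSmoothVec_orthogonal hZ hne (hT hX)
  obtain ⟨Y, hYs, rfl, hZY⟩ := t.exists_isSmoothVec_orthogonal hZ hne (hT hY)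
  -- Fields orthogonal to `Z` are tangent to `S` at its points near `p`. Hence `F = 0` on `S`
  -- implies `X F = Y F = 0` on `S`, and these functions are again killed by tangent vectors.
  have hbr : VectorField.mlieBracket (𝓡 4) X Y p ∈ tangentTo S p := by
    intro V f hV hpV hf hfS
    obtain ⟨F, hF, hFf⟩ := exists_isSmoothFun_eventuallyEq hV hpV hf
    have hF0 : ∀ᶠ x in 𝓝 p, x ∈ S → F x = 0 := by
      filter_upwards [hFf, hV.mem_nhds hpV] with x h1 h2 h3
      rw [h1, hfS x ⟨h3, h2⟩]
    have hWF {W : Π x : M, TangentSpace (𝓡 4) x} (hW : ∀ x, g.val x (Z x) (W x) = 0) :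
        ∀ᶠ x in 𝓝 p, x ∈ S → mvfderiv (𝓡 4) F x (W x) = 0 := by
      filter_upwards [hF0.eventually_nhds, hZl] with x h1 h2 hxS
      refine mvfderiv_eq_zero_of_mem_tangentTo hF h1 ?_
      rw [hl.mem_tangentTo_iff hS hxS, ← h2 hxS, hW]
    have hXF := hF.mvfderiv t hcov hXs
    have hYF := hF.mvfderiv t hcov hYs
    rw [← mvfderiv_congr hFf, mvfderiv_mlieBracket hF hXs hYs hXF hYF,
      mvfderiv_eq_zero_of_mem_tangentTo hXF (hWF hZX) hY,
      mvfderiv_eq_zero_of_mem_tangentTo hYF (hWF hZY) hX, sub_zero]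
  have hd {W : Π x : M, TangentSpace (𝓡 4) x} (hWs : IsSmoothVec W)
      (hW : ∀ x, g.val x (Z x) (W x) = 0) (v : TangentSpace (𝓡 4) p) :
      g.val p (cov Z p v) (W p) = -g.val p (Z p) (cov W p v) := by
    have h := hcov.mvfderiv_metric hZ hWs p v
    simp only [hW, mvfderiv_const, zero_apply] at h
    linarith
  have h := hT hbr
  rw [← hcov.cov_sub_cov hXs hYs, map_sub] at h
  rw [hd hYs hZY, hd hXs hZX]
  linarith

/-- The second fundamental form of a null hypersurface is degenerate in the direction of the null
normal. -/
lemma val_cov_normal_left {X : TangentSpace (𝓡 4) p} (hX : X ∈ tangentTo S p) :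
    g.val p (cov Z p (Z p)) X = 0 := by
  have hlT : Z p ∈ tangentTo S p := hZl.self_of_nhds hp ▸ hl.mem_tangentTo hS hp
  rw [val_cov_symm t hcov hS hl hZ hp hZl hlT hX]
  exact val_cov_normal hcov hS hl hZ hp hZl hX

/-- The second fundamental form in a null tetrad. -/
lemma IsRealTetrad.val_cov_eq {n a b : TangentSpace (𝓡 4) p} (h : IsRealTetrad g p (Z p) n a b)
    {X Y : TangentSpace (𝓡 4) p} (hX : g.val p (Z p) X = 0) (hY : g.val p (Z p) Y = 0) :
    g.val p (cov Z p X) Y = g.val p X a * g.val p Y a * g.val p (cov Z p a) a +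
      (g.val p X a * g.val p Y b + g.val p X b * g.val p Y a) * g.val p (cov Z p a) b +
      g.val p X b * g.val p Y b * g.val p (cov Z p b) b := by
  have hT {X : TangentSpace (𝓡 4) p} (hX : g.val p (Z p) X = 0) : X ∈ tangentTo S p := by
    rw [hl.mem_tangentTo_iff hS hp, ← hZl.self_of_nhds hp]; exact hX
  have h1 {X : TangentSpace (𝓡 4) p} (hX : X ∈ tangentTo S p) :=
    val_cov_normal_left t hcov hS hl hZ hp hZl hX
  have h2 {X : TangentSpace (𝓡 4) p} (hX : X ∈ tangentTo S p) :=
    val_cov_normal hcov hS hl hZ hp hZl hX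
  have hba := val_cov_symm t hcov hS hl hZ hp hZl (hT h.lb) (hT h.la)
  have e1 := h.eq_sum X
  have e2 := h.eq_sum Y
  rw [g.symm p X (Z p), hX, zero_smul, add_zero] at e1
  rw [g.symm p Y (Z p), hY, zero_smul, add_zero] at e2
  have e3 (W : TangentSpace (𝓡 4) p) : g.val p W Y = g.val p Y n * g.val p W (Z p) -
      g.val p Y a * g.val p W a - g.val p Y b * g.val p W b := by
    conv_lhs => rw [e2]
    simp
  have e4 : cov Z p X = g.val p X n • cov Z p (Z p) - g.val p X a • cov Z p a -
      g.val p X b • cov Z p b := by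
    conv_lhs => rw [e1]
    simp
  rw [e3, h2 (hT hX), e4]
  simp only [map_sub, map_smul, sub_apply, smul_apply, smul_eq_mul, h1 (hT h.la), h1 (hT h.lb), hba]
  ring

/-- The derivative along the null normal of a diagonal component of the second fundamental form. -/
lemma mvfderiv_val_cov {n a b : TangentSpace (𝓡 4) p} (h : IsRealTetrad g p (Z p) n a b)
    {E : Π x : M, TangentSpace (𝓡 4) x} (hE : IsSmoothVec E) (hZE : ∀ x, g.val x (Z x) (E x) = 0) :
    mvfderiv (𝓡 4) (fun x ↦ g.val x (cov Z x (E x)) (E x)) p (Z p) =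
      g.val p (cov Z p (Z p)) n * g.val p (cov Z p (E p)) (E p) +
      g.val p (cov Z p (cov E p (Z p) - cov Z p (E p))) (E p) -
      g.val p (riemann cov p (E p) (Z p) (Z p)) (E p) +
      g.val p (cov Z p (E p)) (cov E p (Z p)) := by
  have hET : ∀ᶠ x in 𝓝 p, x ∈ S → E x ∈ tangentTo S x := by
    filter_upwards [hZl] with x hx hxS
    rw [hl.mem_tangentTo_iff hS hxS, ← hx hxS, hZE]
  have hZZ := hZ.cov hcov hZ
  -- The relation `g(∇_Z Z, E) = 0` holds along `S` near `p`; differentiating it along `E` trades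
  -- the term `∇_E ∇_Z Z`, which appears on commuting derivatives, for first derivatives.
  have h0 := mvfderiv_eq_zero_of_mem_tangentTo (IsSmoothFun.metric g hZZ hE) (S := S) (p := p) (by
    filter_upwards [hZl.eventually_nhds, hET] with x h1 h2 hxS
    exact val_cov_normal_left t hcov hS hl hZ hxS h1 (h2 hxS)) (hET.self_of_nhds hp)
  rw [hcov.mvfderiv_metric hZZ hE] at h0
  -- The normal is geodesic: `∇_Z Z = κ Z` at `p`, where `κ` is the product with `n`.
  have hk : cov Z p (Z p) = g.val p (cov Z p (Z p)) n • Z p := h.eq_smul fun w hw ↦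
    val_cov_normal_left t hcov hS hl hZ hp hZl (by
      rw [hl.mem_tangentTo_iff hS hp, ← hZl.self_of_nhds hp]; exact hw)
  have h1 := hcov.mvfderiv_metric hZ hE p (E p)
  simp only [hZE, mvfderiv_const, zero_apply] at h1
  have h2 : g.val p (cov Z p (Z p)) (cov E p (E p)) =
      g.val p (cov Z p (Z p)) n * g.val p (Z p) (cov E p (E p)) := by
    conv_lhs => rw [hk]
    simp
  have hR := riemann_apply hcov t hE hZ hZ p
  rw [riemannFields, ← hcov.cov_sub_cov hE hZ] at hR
  rw [hcov.mvfderiv_metric (hE.cov hcov hZ) hE, hR]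
  simp only [map_sub, sub_apply]
  linear_combination h0 - h2 + (g.val p (cov Z p (Z p)) n) * h1

set_option maxHeartbeats 400000 in
/-- Raychaudhuri's equation for a null hypersurface without expansion: the second fundamental form
vanishes if the Ricci curvature in the null direction is nonnegative. -/
lemma val_cov_eq_zero
    (hexp : ∀ᶠ x in 𝓝 p, x ∈ S → ∀ n a b, IsRealTetrad g x (Z x) n a b →
      g.val x (cov Z x a) a + g.val x (cov Z x b) b = 0)
    (hRic : 0 ≤ ricci g cov p (Z p) (Z p)) {X Y : TangentSpace (𝓡 4) p}
    (hX : X ∈ tangentTo S p) (hY : Y ∈ tangentTo S p) : g.val p (cov Z p X) Y = 0 := by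
  have hZp : Z p = l p := hZl.self_of_nhds hp
  have hne := val_timeOrientation_ne_zero t hS hl hp hZl
  obtain ⟨n, a, b, h⟩ := t.exists_isRealTetrad (l := Z p) (hZp ▸ hl.ne_zero p hp)
    (hZp ▸ hl.val_self hS hp)
  obtain ⟨A, hA, hAp, hZA⟩ := t.exists_isSmoothVec_orthogonal hZ hne h.la
  obtain ⟨B, hB, hBp, hZB⟩ := t.exists_isSmoothVec_orthogonal hZ hne h.lb
  have hlT : Z p ∈ tangentTo S p := hZp ▸ hl.mem_tangentTo hS hp
  -- Away from `p` the fields `A`, `B` need not be orthonormal. The expression is minus the trace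
  -- multiplied by their Gram determinant, so it vanishes on `S` without any orthonormalisation of
  -- the frame.
  have hF : ∀ᶠ x in 𝓝 p, x ∈ S →
      ((fun x ↦ g.val x (B x) (B x)) * (fun x ↦ g.val x (cov Z x (A x)) (A x)) -
        ((fun x ↦ g.val x (A x) (B x)) * (fun x ↦ g.val x (cov Z x (A x)) (B x)) +
          (fun x ↦ g.val x (A x) (B x)) * (fun x ↦ g.val x (cov Z x (A x)) (B x))) +
        (fun x ↦ g.val x (A x) (A x)) * (fun x ↦ g.val x (cov Z x (B x)) (B x))) x = 0 := by
    filter_upwards [hexp, hZl.eventually_nhds] with x hx hx' hxS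
    have hZx : Z x = l x := hx'.self_of_nhds hxS
    obtain ⟨n, a, b, h⟩ := t.exists_isRealTetrad (l := Z x) (hZx ▸ hl.ne_zero x hxS)
      (hZx ▸ hl.val_self hS hxS)
    have hv {X Y : TangentSpace (𝓡 4) x} (hX : g.val x (Z x) X = 0) (hY : g.val x (Z x) Y = 0) :
        g.val x X Y = -(g.val x X a * g.val x Y a) - g.val x X b * g.val x Y b := by
      conv_lhs => rw [h.eq_sum X]
      simp only [map_add, map_sub, map_smul, add_apply, sub_apply, smul_apply, smul_eq_mul, hY,
        g.symm x X (Z x), hX, g.symm x a Y, g.symm x b Y]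
      ring
    have hq {X Y : TangentSpace (𝓡 4) x} (hX : g.val x (Z x) X = 0) (hY : g.val x (Z x) Y = 0) :=
      h.val_cov_eq t hcov hS hl hZ hxS hx' hX hY
    have h0 := hx hxS n a b h
    simp only [Pi.add_apply, Pi.sub_apply, Pi.mul_apply]
    rw [hq (hZA x) (hZA x), hq (hZA x) (hZB x), hq (hZB x) (hZB x), hv (hZA x) (hZA x),
      hv (hZA x) (hZB x), hv (hZB x) (hZB x)]
    linear_combination (-(g.val x (A x) a * g.val x (B x) b -
      g.val x (A x) b * g.val x (B x) a) ^ 2) * h0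
  have gAA := IsSmoothFun.metric g hA hA
  have gAB := IsSmoothFun.metric g hA hB
  have gBB := IsSmoothFun.metric g hB hB
  have bAA := IsSmoothFun.metric g (hA.cov hcov hZ) hA
  have bAB := IsSmoothFun.metric g (hA.cov hcov hZ) hB
  have bBB := IsSmoothFun.metric g (hB.cov hcov hZ) hB
  have hd := mvfderiv_eq_zero_of_mem_tangentTo
    (((gBB.mul bAA).sub ((gAB.mul bAB).add (gAB.mul bAB))).add (gAA.mul bBB)) hF hlT
  rw [mvfderiv_add (((gBB.mul bAA).sub ((gAB.mul bAB).add (gAB.mul bAB))).mdifferentiableAt p)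
      ((gAA.mul bBB).mdifferentiableAt p),
    mvfderiv_sub ((gBB.mul bAA).mdifferentiableAt p)
      (((gAB.mul bAB).add (gAB.mul bAB)).mdifferentiableAt p),
    mvfderiv_add ((gAB.mul bAB).mdifferentiableAt p) ((gAB.mul bAB).mdifferentiableAt p),
    mvfderiv_mul (gBB.mdifferentiableAt p) (bAA.mdifferentiableAt p),
    mvfderiv_mul (gAB.mdifferentiableAt p) (bAB.mdifferentiableAt p),
    mvfderiv_mul (gAA.mdifferentiableAt p) (bBB.mdifferentiableAt p)] at hd
  simp only [add_apply, sub_apply, smul_apply, smul_eq_mul, hcov.mvfderiv_metric hA hA,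
    hcov.mvfderiv_metric hA hB, hcov.mvfderiv_metric hB hB,
    mvfderiv_val_cov t hcov hS hl hZ hp hZl h hA hZA,
    mvfderiv_val_cov t hcov hS hl hZ hp hZl h hB hZB, hAp, hBp, h.aa, h.bb, h.ab] at hd
  have hR := h.ricci_eq hcov t
  have h0 := hexp.self_of_nhds hp n a b h
  have hq {X Y : TangentSpace (𝓡 4) p} (hX : g.val p (Z p) X = 0) (hY : g.val p (Z p) Y = 0) :=
    h.val_cov_eq t hcov hS hl hZ hp hZl hX hY
  have hv {X Y : TangentSpace (𝓡 4) p} (hX : g.val p (Z p) X = 0) (hY : g.val p (Z p) Y = 0) :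
      g.val p X Y = -(g.val p X a * g.val p Y a) - g.val p X b * g.val p Y b := by
    conv_lhs => rw [h.eq_sum X]
    simp only [map_add, map_sub, map_smul, add_apply, sub_apply, smul_apply, smul_eq_mul, hY,
      g.symm p X (Z p), hX, g.symm p a Y, g.symm p b Y]
    ring
  have hT {X : TangentSpace (𝓡 4) p} (hX : g.val p (Z p) X = 0) : X ∈ tangentTo S p := by
    rw [hl.mem_tangentTo_iff hS hp, ← hZp]; exact hX
  have hDT {X : TangentSpace (𝓡 4) p} (hX : g.val p (Z p) X = 0) : g.val p (Z p) (cov Z p X) = 0 := by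
    rw [g.symm]; exact val_cov_normal hcov hS hl hZ hp hZl (hT hX)
  have hET {E : Π x : M, TangentSpace (𝓡 4) x} (hE : IsSmoothVec E)
      (hZE : ∀ x, g.val x (Z x) (E x) = 0) (hEp : g.val p (Z p) (E p) = 0) :
      g.val p (Z p) (cov E p (Z p)) = 0 := by
    have h1 := hcov.mvfderiv_metric hZ hE p (Z p)
    simp only [hZE, mvfderiv_const, zero_apply,
      val_cov_normal_left t hcov hS hl hZ hp hZl (hT hEp)] at h1
    linarith
  have hAT := hET hA hZA (hZA p)
  have hBT := hET hB hZB (hZB p)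
  have hba := val_cov_symm t hcov hS hl hZ hp hZl (hT h.lb) (hT h.la)
  have sub0 {X Y : TangentSpace (𝓡 4) p} (hX : g.val p (Z p) X = 0) (hY : g.val p (Z p) Y = 0) :
      g.val p (Z p) (X - Y) = 0 := by rw [map_sub, hX, hY, sub_zero]
  rw [hq (sub0 hAT (hDT h.la)) h.la, hq (sub0 hBT (hDT h.lb)) h.lb, hv (hDT h.la) hAT,
    hv (hDT h.lb) hBT] at hd
  have hba' := h.ab
  rw [g.symm] at hba'
  simp only [map_sub, sub_apply, h.aa, h.bb, h.ab, hba', hba, g.symm p a (cov A p (Z p)),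
    g.symm p a (cov B p (Z p)), g.symm p b (cov B p (Z p))] at hd
  -- Because the trace is zero, the terms with `g(∇_Z Z, n)` drop out and those with `∇_Z A`, `∇_Z
  -- B` cancel against the derivatives of the Gram coefficients. Only `Ric(l,l)` and the squares
  -- remain.
  have hsq : ricci g cov p (Z p) (Z p) + g.val p (cov Z p a) a ^ 2 + g.val p (cov Z p b) b ^ 2 +
      2 * g.val p (cov Z p a) b ^ 2 = 0 := by
    rw [hR]
    have h0' : g.val p (cov Z p b) b = -g.val p (cov Z p a) a := by linarith
    rw [h0'] at hd ⊢
    linear_combination (-1 : ℝ) * hd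
  obtain ⟨haa, hbb, hab⟩ := eq_zero_of_add_sq_eq_zero hRic hsq
  rw [hq (hZp ▸ (hl.mem_tangentTo_iff hS hp).1 hX) (hZp ▸ (hl.mem_tangentTo_iff hS hp).1 hY),
    haa, hab, hbb]
  ring

end Weingarten

/-! ### Proportionality of the derivative to the normal, and the rotation 1-form -/

section RotationForm

variable {M : Type*} [TopologicalSpace M] [ChartedSpace E4 M]
  [IsManifold (𝓡 4) ∞ M] {g : LorentzMetric M} {t : TimeOrientation g} {cov : Connection M}
  {S : Set M} {l : Π x : M, TangentSpace (𝓡 4) x}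

lemma inducedDeriv_zero {p : M} (hp : p ∈ S) {X : TangentSpace (𝓡 4) p} (hX : X ∈ tangentTo S p) :
    inducedDeriv cov S (fun _ ↦ 0) p X = 0 := by
  rw [inducedDeriv_eq cov hp hX (Y := fun _ ↦ 0) (Z := 0) ⟨Set.univ, isOpen_univ, trivial,
    (Bundle.contMDiff_zeroSection ℝ (fun x : M ↦ TangentSpace (𝓡 4) x)).contMDiffOn,
    fun _ _ ↦ rfl⟩]
  simp

lemma derivC_ofReal (Y : Π x : M, TangentSpace (𝓡 4) x) {p : M} (hp : p ∈ S)
    {u : CVec (TangentSpace (𝓡 4) p)} (hre : u.re ∈ tangentTo S p) (him : u.im ∈ tangentTo S p) :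
    derivC cov S (fun x ↦ CVec.ofReal (Y x)) p u =
      ⟨inducedDeriv cov S Y p u.re, inducedDeriv cov S Y p u.im⟩ := by
  simp only [derivC, CVec.ofReal, inducedDeriv_zero hp hre, inducedDeriv_zero hp him, sub_zero,
    add_zero]

lemma derivC_apply_ofReal (Y : Π x : M, CVec (TangentSpace (𝓡 4) x)) {p : M}
    (u : TangentSpace (𝓡 4) p) : derivC cov S Y p (CVec.ofReal u) =
      ⟨inducedDeriv cov S (fun x ↦ (Y x).re) p u, inducedDeriv cov S (fun x ↦ (Y x).im) p u⟩ := by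
  simp [derivC, CVec.ofReal]

variable {T : Π x : M, TangentSpace (𝓡 4) x →L[ℝ] TangentSpace (𝓡 4) x →L[ℝ] ℝ}

/-- Einstein's equations and the energy condition make `Ric(l,l)` nonnegative. -/
lemma IsNonExpandingHorizon.ricci_nonneg (hS : IsNonExpandingHorizon g t cov T S)
    (hl : IsNormalField g S l) {p : M} (hp : p ∈ S) : 0 ≤ ricci g cov p (l p) (l p) := by
  have hll := hl.val_self hS.null hp
  have hT {L : TangentSpace (𝓡 4) p} (hL0 : L ≠ 0)
      (hL : ∀ X ∈ tangentTo S p, g.val p L X = 0) (hLf : FutureCausal t p L) : 0 ≤ T p L L := by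
    obtain ⟨V, hV⟩ : ∃ V, ∀ w, g.val p V w = T p w L := by
      let T' : E4 →L[ℝ] E4 →L[ℝ] ℝ := T p
      exact ⟨g.sharp (T'.flip L), fun w ↦ g.val_sharp _ w⟩
    rw [← hV]
    exact (hS.energy p hp L hL0 hL hLf V hV).val_nonneg hLf
  have h : 0 ≤ T p (l p) (l p) := by
    -- The normal may point to the past; `T(l,l)` does not change under `l ↦ -l`.
    rcases le_total 0 (g.val p (l p) (t.field p)) with h | h
    · exact hT (hl.ne_zero p hp) (hl.normal p hp) ⟨hll.ge, h⟩
    · simpa using hT (L := -l p) (neg_ne_zero.2 (hl.ne_zero p hp))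
        (fun X hX ↦ by simp [hl.normal p hp X hX]) ⟨by simp [hll], by simpa using h⟩
  -- Since `l` is null, the scalar curvature term disappears.
  have hE := hS.einstein p hp (l p) (l p)
  rw [hll, mul_zero, sub_zero] at hE
  rw [hE]
  positivity

variable [T2Space M]

lemma inducedDeriv_eq_cov {Y Z : Π x : M, TangentSpace (𝓡 4) x} (hZ : IsSmoothVec Z) {p : M}
    (hp : p ∈ S) (h : ∀ᶠ x in 𝓝 p, x ∈ S → Z x = Y x) {X : TangentSpace (𝓡 4) p}
    (hX : X ∈ tangentTo S p) : inducedDeriv cov S Y p X = cov Z p X :=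
  inducedDeriv_eq cov hp hX (isVecExtensionAt_of_eventually hZ h)

/-- For `m = (a + i b)/√2` the real part of the expansion is minus the sum of the two diagonal
components. -/
lemma IsNonExpandingHorizon.sum_val_cov_eq_zero (hS : IsNonExpandingHorizon g t cov T S)
    (hl : IsNormalField g S l) {Z : Π x : M, TangentSpace (𝓡 4) x} (hZ : IsSmoothVec Z) {p : M}
    (hp : p ∈ S) (hZl : ∀ᶠ x in 𝓝 p, x ∈ S → Z x = l x) {n a b : TangentSpace (𝓡 4) p}
    (h : IsRealTetrad g p (Z p) n a b) : g.val p (cov Z p a) a + g.val p (cov Z p b) b = 0 := by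
  have hZp : Z p = l p := hZl.self_of_nhds hp
  have hT {X : TangentSpace (𝓡 4) p} (hX : g.val p (Z p) X = 0) (c : ℝ) :
      c • X ∈ tangentTo S p := by
    rw [hl.mem_tangentTo_iff hS.null hp, ← hZp, map_smul, hX, smul_zero]
  have h0 := hS.expansion_eq_zero l hl p hp n _ (hZp ▸ h.isNullTetrad)
  have ha := hT h.la (√2)⁻¹
  have hb := hT h.lb (√2)⁻¹
  have hb' : -((√2)⁻¹ • b) ∈ tangentTo S p := Submodule.neg_mem _ hb
  have hm : derivC cov S (fun x ↦ CVec.ofReal (l x)) p ⟨(√2)⁻¹ • a, (√2)⁻¹ • b⟩ = _ :=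
    derivC_ofReal l hp ha hb
  have hmbar : derivC cov S (fun x ↦ CVec.ofReal (l x)) p
      (CVec.conj ⟨(√2)⁻¹ • a, (√2)⁻¹ • b⟩) = _ := derivC_ofReal l hp ha hb'
  rw [expansion, hm, hmbar] at h0
  have h1 := congrArg Complex.re h0
  simp only [gC, CVec.conj, Complex.sub_re, Complex.neg_re, Complex.zero_re,
    inducedDeriv_eq_cov hZ hp hZl ha, inducedDeriv_eq_cov hZ hp hZl hb,
    inducedDeriv_eq_cov hZ hp hZl hb', map_smul, map_neg, smul_apply, neg_apply,
    smul_eq_mul] at h1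
  rw [g.symm p _ a, g.symm p _ b]
  linear_combination -h1 - (2 : ℝ) * (g.val p a (cov Z p a) +
    g.val p b (cov Z p b)) * inv_sqrt_two_mul_self

variable (hcov : IsLeviCivita g cov) (hS : IsNonExpandingHorizon g t cov T S)
  (hl : IsNormalField g S l)

include hcov hS hl

/-- On a non-expanding horizon the derivative of a null normal is proportional to it. -/
lemma inducedDeriv_normal {p : M} (hp : p ∈ S) {X ν : TangentSpace (𝓡 4) p}
    (hX : X ∈ tangentTo S p) (hν : g.val p (l p) ν = 1) :
    inducedDeriv cov S l p X = g.val p ν (inducedDeriv cov S l p X) • l p := by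
  obtain ⟨Z, hZ, hZl⟩ := hl.smooth.exists_isSmoothVec hp
  have hZp : Z p = l p := hZl.self_of_nhds hp
  rw [inducedDeriv_eq_cov hZ hp hZl hX]
  obtain ⟨n, a, b, h⟩ := t.exists_isRealTetrad (hl.ne_zero p hp) (hl.val_self hS.null hp)
  -- The second fundamental form vanishes, so `∇_X Z` is orthogonal to all of `l^⊥`. Raychaudhuri's
  -- equation differentiates the trace, so its vanishing is supplied at all points of `S` near `p`.
  have key : cov Z p X = g.val p (cov Z p X) n • l p := h.eq_smul fun Y hY ↦
    val_cov_eq_zero t hcov hS.null hl hZ hp hZl (by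
      filter_upwards [hZl.eventually_nhds] with x hx hxS n a b h
      exact hS.sum_val_cov_eq_zero hl hZ hxS hx h)
      (hZp ▸ hS.ricci_nonneg hl hp) hX ((hl.mem_tangentTo_iff hS.null hp).2 hY)
  have h1 : g.val p ν (cov Z p X) = g.val p (cov Z p X) n := by
    rw [g.symm]
    conv_lhs => rw [key]
    simp [hν]
  rw [h1]
  exact key

omit hcov hS hl in
/-- The 1-form `Y ↦ n · 𝒟_{PY} l`, where `PY = Y - (l · Y) n` is the projection to the horizon
along the transverse field `n`. -/
def rotForm (g : LorentzMetric M) (cov : Connection M) (S : Set M)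
    (l n : Π x : M, TangentSpace (𝓡 4) x) (p : M) : TangentSpace (𝓡 4) p →L[ℝ] ℝ :=
  (g.val p (n p)).comp ((inducedDeriv cov S l p).comp
    (ContinuousLinearMap.id ℝ _ - (g.val p (l p)).smulRight (n p)))

omit hcov hS hl in
lemma rotForm_apply (n : Π x : M, TangentSpace (𝓡 4) x) (p : M) (Y : TangentSpace (𝓡 4) p) :
    rotForm g cov S l n p Y =
      g.val p (n p) (inducedDeriv cov S l p (Y - g.val p (l p) Y • n p)) := rfl

omit hcov in
lemma sub_smul_mem_tangentTo {p : M} (hp : p ∈ S) {ν : TangentSpace (𝓡 4) p}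
    (hν : g.val p (l p) ν = 1) (Y : TangentSpace (𝓡 4) p) :
    Y - g.val p (l p) Y • ν ∈ tangentTo S p := by
  rw [hl.mem_tangentTo_iff hS.null hp]
  simp [hν]

/-- Only `l·n = 1` matters here: on tangent vectors the projection along `n` is the identity,
whatever transversal is used. -/
lemma isRotationalForm_rotForm {n : Π x : M, TangentSpace (𝓡 4) x} (hn : SmoothVecOn S n)
    (hln : ∀ p ∈ S, g.val p (l p) (n p) = 1) :
    IsRotationalForm cov S l (rotForm g cov S l n) := by
  refine ⟨fun p hp ↦ ?_, fun p hp X hX ↦ ?_⟩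
  · obtain ⟨Z, hZ, hZl⟩ := hl.smooth.exists_isSmoothVec hp
    obtain ⟨N, hN, hNn⟩ := hn.exists_isSmoothVec hp
    -- Replacing `l`, `n` and the induced derivative by `Z`, `N` and `∇` gives a form defined off
    -- `S`. On `S` near `p` it agrees with `rotForm` because the projected argument is tangent,
    -- where the choice of extension is irrelevant.
    let β : Π x : M, TangentSpace (𝓡 4) x →L[ℝ] ℝ := fun x ↦ (g.val x (N x)).comp ((cov Z x).comp
      (ContinuousLinearMap.id ℝ _ - (g.val x (Z x)).smulRight (N x)))
    have hβ : ∀ X, IsSmoothVec X → IsSmoothFun fun x ↦ β x (X x) := fun X hX ↦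
      IsSmoothFun.metric g hN ((hX.sub (hN.smul (IsSmoothFun.metric g hZ hX))).cov hcov hZ)
    obtain ⟨U, hU, hUo, hpU⟩ := eventually_nhds_iff.1 (hZl.eventually_nhds.and hNn)
    refine ⟨β, U, hUo, hpU, (contMDiff_of_isSmoothFun_apply g hβ).contMDiffOn, fun x hx ↦ ?_⟩
    obtain ⟨h1, h2⟩ := hU x hx.2
    ext Y
    rw [rotForm_apply, inducedDeriv_eq_cov hZ hx.1 h1
      (sub_smul_mem_tangentTo hS hl hx.1 (hln x hx.1) Y), ← h2 hx.1, ← h1.self_of_nhds hx.1]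
    rfl
  · rw [rotForm_apply, hl.normal p hp X hX, zero_smul, sub_zero]
    exact inducedDeriv_normal hcov hS hl hp hX (hln p hp)

/-- The rescaled time orientation is a transversal available without a parameter `v`, as a nonzero
null vector is never orthogonal to a timelike one. -/
lemma exists_isRotationalForm : ∃ rot, IsRotationalForm cov S l rot := by
  have hne {p : M} (hp : p ∈ S) : g.val p (l p) (t.field p) ≠ 0 :=
    t.val_ne_zero (hl.ne_zero p hp) (hl.val_self hS.null hp)
  refine ⟨_, isRotationalForm_rotForm hcov hS hl
    (n := fun x ↦ (g.val x (l x) (t.field x))⁻¹ • t.field x) (fun p hp ↦ ?_) fun p hp ↦ ?_⟩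
  · obtain ⟨Z, hZ, hZl⟩ := hl.smooth.exists_isSmoothVec hp
    have ht : IsSmoothVec t.field := t.smooth
    have hZt : IsSmoothFun fun x ↦ g.val x (Z x) (t.field x) := IsSmoothFun.metric g hZ ht
    have hp0 : g.val p (Z p) (t.field p) ≠ 0 := hZl.self_of_nhds hp ▸ hne hp
    obtain ⟨U, hU, hUo, hpU⟩ := eventually_nhds_iff.1
      (hZl.and ((ContMDiff.continuous hZt).continuousAt.eventually_ne hp0))
    refine ⟨(fun x ↦ (g.val x (Z x) (t.field x))⁻¹) • t.field, U, hUo, hpU, fun x hx ↦ ?_,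
      fun x hx ↦ ?_⟩
    · exact (((hZt x).inv₀ (hU x hx).2).smul_section (ht x)).contMDiffWithinAt
    · simp [(hU x hx.2).1 hx.1]
  · simp [hne hp]

end RotationForm

/-! ### The null transversal determined by the cuts -/

section AdaptedTetrad

variable {M : Type*} [TopologicalSpace M] [ChartedSpace E4 M]
  [IsManifold (𝓡 4) ∞ M] {g : LorentzMetric M} {t : TimeOrientation g} {cov : Connection M}
  {S : Set M} {l : Π x : M, TangentSpace (𝓡 4) x}

/-- The null field transverse to `S` with `l · n = 1` which is orthogonal to the cuts
`v = const`. -/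
def cutNormal (g : LorentzMetric M) (S : Set M) (l : Π x : M, TangentSpace (𝓡 4) x) (v : M → ℝ)
    (p : M) : TangentSpace (𝓡 4) p :=
  g.sharp (diffOn S v p) -
    (g.val p (g.sharp (diffOn S v p)) (g.sharp (diffOn S v p)) / 2) • l p

lemma null_sub_smul {p : M} {L A : TangentSpace (𝓡 4) p} (hL : g.val p L L = 0)
    (hLA : g.val p L A = 1) :
    g.val p (A - (g.val p A A / 2) • L) (A - (g.val p A A / 2) • L) = 0 := by
  simp only [map_sub, map_smul, sub_apply, smul_apply, smul_eq_mul, hL, hLA, g.symm p A L]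
  ring

/-- Agreement on `L^⊥` leaves only `N' = N - c L`; the norm of this vector is `-2c`, so nullness
forces `c = 0`. -/
lemma TimeOrientation.eq_of_null (t : TimeOrientation g) {p : M} {L N N' : TangentSpace (𝓡 4) p}
    (hL0 : L ≠ 0) (hL : g.val p L L = 0) (hN : g.val p N N = 0) (hN' : g.val p N' N' = 0)
    (hLN : g.val p L N = 1) (h : ∀ X, g.val p L X = 0 → g.val p N X = g.val p N' X) : N = N' := by
  obtain ⟨n, a, b, ht⟩ := t.exists_isRealTetrad hL0 hL
  have h1 := ht.eq_smul (v := N - N') fun w hw ↦ by simp [h w hw]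
  generalize g.val p (N - N') n = c at h1
  have h2 : N' = N - c • L := by rw [← h1]; abel
  rw [h2] at hN'
  simp only [map_sub, map_smul, sub_apply, smul_apply, smul_eq_mul, hL, hN, hLN,
    g.symm p N L] at hN'
  have hc : c = 0 := by linarith
  rw [h2, hc, zero_smul, sub_zero]

variable {v : M → ℝ} (hS : IsNullHypersurface g S) (hl : IsNormalField g S l)
  (hv : IsParameter S l v)

include hv in
lemma val_cutNormal_left (hS : IsNullHypersurface g S) (hl : IsNormalField g S l) {p : M}
    (hp : p ∈ S) : g.val p (l p) (cutNormal g S l v p) = 1 := by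
  rw [cutNormal, map_sub, map_smul, hl.val_self hS hp, smul_zero, sub_zero, g.symm, g.val_sharp]
  exact hv.2 p hp

include hv in
lemma val_cutNormal_self (hS : IsNullHypersurface g S) (hl : IsNormalField g S l) {p : M}
    (hp : p ∈ S) : g.val p (cutNormal g S l v p) (cutNormal g S l v p) = 0 :=
  null_sub_smul (hl.val_self hS hp) (by rw [g.symm, g.val_sharp]; exact hv.2 p hp)

lemma val_cutNormal {p : M} {X : TangentSpace (𝓡 4) p}
    (hX : g.val p (l p) X = 0) : g.val p (cutNormal g S l v p) X = diffOn S v p X := by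
  simp [cutNormal, hX, g.val_sharp]

include t hS hl hv

/-- At each point `diffOn` uses some extension of `v`, so as a full covector it need not vary
smoothly. Two extensions have the same differential on `l^⊥`, hence dual vectors differing by a
multiple of `l`, and the correction to a null vector removes this ambiguity. A single smooth
extension `F` therefore computes the field near `p`. -/
lemma smoothVecOn_cutNormal [T2Space M] (hcov : IsLeviCivita g cov) :
    SmoothVecOn S (cutNormal g S l v) := by
  intro p hp
  obtain ⟨Z, hZ, hZl⟩ := hl.smooth.exists_isSmoothVec hp
  obtain ⟨F, hF, hFv⟩ := hv.1.exists_isSmoothFun hp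
  have hA : IsSmoothVec fun x ↦ g.sharp (mvfderiv (𝓡 4) F x) :=
    IsSmoothVec.sharp g fun X hX ↦ hF.mvfderiv t hcov hX
  set A : Π x : M, TangentSpace (𝓡 4) x := fun x ↦ g.sharp (mvfderiv (𝓡 4) F x) with hAdef
  have hc : IsSmoothFun fun x ↦ g.val x (A x) (A x) / 2 := by
    have := (IsSmoothFun.metric g hA hA).mul (isSmoothFun_const (2⁻¹ : ℝ))
    exact this
  refine ⟨A - (fun x ↦ g.val x (A x) (A x) / 2) • Z,
    isVecExtensionAt_of_eventually (hA.sub (hZ.smul hc)) ?_⟩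
  filter_upwards [hZl, hFv.eventually_nhds] with x h1 h2 hxS
  have hF' : IsFunExtensionAt S v x F := by
    obtain ⟨U, hU, hUo, hxU⟩ := eventually_nhds_iff.1 h2
    exact ⟨U, hUo, hxU, ContMDiff.contMDiffOn hF, fun y hy ↦ hU y hy.2 hy.1⟩
  have hll := hl.val_self hS hxS
  have hFd {X : TangentSpace (𝓡 4) x} (hX : g.val x (l x) X = 0) :
      mvfderiv (𝓡 4) F x X = diffOn S v x X :=
    (diffOn_eq ((hl.mem_tangentTo_iff hS hxS).2 hX) hF').symm
  have hlA : g.val x (l x) (A x) = 1 := by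
    rw [g.symm, hAdef, g.val_sharp, hFd hll]
    exact hv.2 x hxS
  rw [Pi.sub_apply, Pi.smul_apply', h1 hxS]
  refine t.eq_of_null (hl.ne_zero x hxS) hll (null_sub_smul hll hlA)
    (val_cutNormal_self hv hS hl hxS) (by simp [hlA, hll]) fun X hX ↦ ?_
  rw [val_cutNormal hX, ← hFd hX]
  simp [hX, hAdef, g.val_sharp]

/-- On `l^⊥`, spanned by `l`, `Re m` and `Im m`, the product with `n` coincides with `dv`: both give
1 on `l` and 0 on `m`. Hence `n` is the same for all adapted tetrads. -/
lemma IsAdaptedTetrad.eq_cutNormal {U : Set M} {n : Π x : M, TangentSpace (𝓡 4) x}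
    {m : Π x : M, CVec (TangentSpace (𝓡 4) x)} (h : IsAdaptedTetrad g cov S l v U n m) {p : M}
    (hp : p ∈ S ∩ U) : n p = cutNormal g S l v p := by
  have ht := h.tetrad p hp
  refine t.eq_of_null (hl.ne_zero p hp.1) ht.ll ht.nn (val_cutNormal_self hv hS hl hp.1) ht.ln
    fun X hX ↦ ?_
  rw [val_cutNormal hX]
  conv_rhs => rw [ht.isRealTetrad.eq_sum X]
  obtain ⟨h1, h2⟩ := h.tangent_cut p hp
  simp [h1, h2, g.symm p X, hX, hv.2 p hp.1]

end AdaptedTetrad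

/-! ### The rotation 1-form in terms of spin coefficients -/

section TetradForm

variable {M : Type*} [TopologicalSpace M] [T2Space M] [ChartedSpace E4 M]
  [IsManifold (𝓡 4) ∞ M] {g : LorentzMetric M} {t : TimeOrientation g} {cov : Connection M}
  {S : Set M} {l : Π x : M, TangentSpace (𝓡 4) x}
  {T : Π x : M, TangentSpace (𝓡 4) x →L[ℝ] TangentSpace (𝓡 4) x →L[ℝ] ℝ}

lemma SmoothVecOn.exists_isSmoothVec_of_inter {U : Set M} (hU : IsOpen U)
    {Y : Π x : M, TangentSpace (𝓡 4) x} (hY : SmoothVecOn (S ∩ U) Y) {p : M} (hp : p ∈ S ∩ U) :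
    ∃ Z, IsSmoothVec Z ∧ ∀ᶠ x in 𝓝 p, x ∈ S → Z x = Y x := by
  obtain ⟨Z, hZ, h⟩ := hY.exists_isSmoothVec hp
  refine ⟨Z, hZ, ?_⟩
  filter_upwards [h, hU.mem_nhds hp.2] with x h1 h2 h3
  exact h1 ⟨h3, h2⟩

/-- Leibniz rule along `S` for fields with constant scalar product. -/
lemma val_inducedDeriv_add_eq_zero (hcov : IsLeviCivita g cov) {Y W Y' W' : Π x : M, TangentSpace (𝓡 4) x}
    (hY : IsSmoothVec Y) (hW : IsSmoothVec W) {p : M} (hp : p ∈ S)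
    (hYY' : ∀ᶠ x in 𝓝 p, x ∈ S → Y x = Y' x) (hWW' : ∀ᶠ x in 𝓝 p, x ∈ S → W x = W' x)
    (h0 : ∀ᶠ x in 𝓝 p, x ∈ S → g.val x (Y' x) (W' x) = 0) {X : TangentSpace (𝓡 4) p}
    (hX : X ∈ tangentTo S p) :
    g.val p (inducedDeriv cov S Y' p X) (W' p) + g.val p (Y' p) (inducedDeriv cov S W' p X) = 0 := by
  rw [inducedDeriv_eq_cov hY hp hYY' hX, inducedDeriv_eq_cov hW hp hWW' hX,
    ← hYY'.self_of_nhds hp, ← hWW'.self_of_nhds hp, ← hcov.mvfderiv_metric hY hW]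
  refine mvfderiv_eq_zero_of_mem_tangentTo (IsSmoothFun.metric g hY hW) ?_ hX
  filter_upwards [hYY', hWW', h0] with x h1 h2 h3 hxS
  rw [h1 hxS, h2 hxS, h3 hxS]

/-- Lie dragging gives `Dm = 𝒟_m l = ω(m) l`. Then `m̄·Dm = 0`, so `ε = ω(l)/2` is real, and
differentiating `m·n = 0` along `l` gives `π = -m̄·Dn = n·Dm̄ = ω(m̄)`. It remains to expand `Y` in
the tetrad. -/
lemma rotForm_eq_tetradForm (hcov : IsLeviCivita g cov) (hS : IsNonExpandingHorizon g t cov T S)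
    (hl : IsNormalField g S l) {v : M → ℝ} (hv : IsParameter S l v) {U : Set M} (hU : IsOpen U)
    {n : Π x : M, TangentSpace (𝓡 4) x} {m : Π x : M, CVec (TangentSpace (𝓡 4) x)}
    (h : IsAdaptedTetrad g cov S l v U n m) {p : M} (hp : p ∈ S ∩ U) (Y : TangentSpace (𝓡 4) p) :
    (rotForm g cov S l (cutNormal g S l v) p Y : ℂ) = tetradForm g cov S l n m p Y := by
  have ht := h.tetrad p hp
  obtain ⟨h1, h2, h3, h4, h5, h6, h7⟩ := ht.val_re_im
  have hlT := hl.mem_tangentTo hS.null hp.1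
  have hre := (hl.mem_tangentTo_iff hS.null hp.1).2 h1
  have him := (hl.mem_tangentTo_iff hS.null hp.1).2 h2
  have hrot := isRotationalForm_rotForm hcov hS hl
    (smoothVecOn_cutNormal (t := t) hS.null hl hv hcov)
    (fun p hp ↦ val_cutNormal_left hv hS.null hl hp)
  have hρ {X : TangentSpace (𝓡 4) p} (hX : X ∈ tangentTo S p) := hrot.2 p hp.1 X hX
  -- The tetrad vector `n` is the direction of projection in `rotForm`, so the form annihilates it.
  have hρn : rotForm g cov S l (cutNormal g S l v) p (n p) = 0 := by
    rw [rotForm_apply, ht.ln, h.eq_cutNormal (t := t) hS.null hl hv hp]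
    simp
  generalize rotForm g cov S l (cutNormal g S l v) p = ρ at hρ hρn
  have hlie := h.lie_dragged p hp
  rw [derivC_apply_ofReal, derivC_ofReal l hp.1 hre him, hρ hre, hρ him] at hlie
  have hDre := congrArg CVec.re hlie
  have hDim := congrArg CVec.im hlie
  obtain ⟨N, hN, hNn⟩ := h.smooth_n.exists_isSmoothVec_of_inter hU hp
  obtain ⟨A, hA, hAm⟩ := h.smooth_m_re.exists_isSmoothVec_of_inter hU hp
  obtain ⟨B, hB, hBm⟩ := h.smooth_m_im.exists_isSmoothVec_of_inter hU hp
  have hA0 := val_inducedDeriv_add_eq_zero hcov hA hN hp.1 hAm hNn (by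
    filter_upwards [hU.mem_nhds hp.2] with x hxU hxS
    rw [g.symm]
    exact (h.tetrad x ⟨hxS, hxU⟩).val_re_im.2.2.1) hlT
  have hB0 := val_inducedDeriv_add_eq_zero hcov hB hN hp.1 hBm hNn (by
    filter_upwards [hU.mem_nhds hp.2] with x hxU hxS
    rw [g.symm]
    exact (h.tetrad x ⟨hxS, hxU⟩).val_re_im.2.2.2.1) hlT
  simp only [] at hDre hDim hA0 hB0
  rw [hDre, map_smul, smul_apply, ht.ln, smul_eq_mul, mul_one] at hA0
  rw [hDim, map_smul, smul_apply, ht.ln, smul_eq_mul, mul_one] at hB0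
  have hnl := ht.ln
  rw [g.symm] at hnl
  have hml := h1
  rw [g.symm] at hml
  have hml' := h2
  rw [g.symm] at hml'
  have hε : spinEps g cov S l n m p = (ρ (l p) / 2 : ℝ) := by
    rw [spinEps, derivC_apply_ofReal, derivC_apply_ofReal, hDre, hDim]
    simp only [CVec.ofReal, inducedDeriv_zero hp.1 hlT, hρ hlT]
    apply Complex.ext <;> simp [gC, CVec.conj, hnl, hml, hml']
  have hπ : spinPi g cov S l n m p = ⟨ρ (m p).re, -ρ (m p).im⟩ := by
    rw [spinPi, derivC_apply_ofReal]
    simp only [CVec.ofReal, inducedDeriv_zero hp.1 hlT]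
    apply Complex.ext <;> simp [gC, CVec.conj] <;> linarith
  -- The real tetrad vectors are `√2 Re m` and `√2 Im m`; their factors of 2 match the sum of the
  -- `π` term and its conjugate.
  have hs : √2 * √2 = (2 : ℝ) := Real.mul_self_sqrt (by norm_num)
  have hY := congrArg ρ (ht.isRealTetrad.eq_sum Y)
  simp only [map_sub, map_add, map_smul, hρn, smul_eq_mul, mul_zero, add_zero] at hY
  rw [tetradForm, hε, hπ, hY, g.symm p Y, g.symm p Y, g.symm p Y]
  apply Complex.ext
  · simp [gC, CVec.ofReal, CVec.conj]
    linear_combination (-(g.val p (m p).re Y * ρ (m p).re) - g.val p (m p).im Y * ρ (m p).im) * hs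
  · simp [gC, CVec.ofReal, CVec.conj]
    ring

end TetradForm

end Horizon

end

theorem mainTheorem4 {M : Type*} [TopologicalSpace M] [T2Space M] [SecondCountableTopology M]
    [ChartedSpace Horizon.E4 M] [IsManifold (𝓡 4) ∞ M]
    (g : Horizon.LorentzMetric M) (t : Horizon.TimeOrientation g)
    (cov : Horizon.Connection M) (hcov : Horizon.IsLeviCivita g cov)
    (T : Π x : M, TangentSpace (𝓡 4) x →L[ℝ] TangentSpace (𝓡 4) x →L[ℝ] ℝ)
    (S : Set M) (hS : Horizon.IsNonExpandingHorizon g t cov T S)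
    (l : Π x : M, TangentSpace (𝓡 4) x) (hl : Horizon.IsNormalField g S l) :
    (∃ rot : Π x : M, TangentSpace (𝓡 4) x →L[ℝ] ℝ, Horizon.IsRotationalForm cov S l rot) ∧
    ∀ v : M → ℝ, Horizon.IsParameter S l v →
      ∃ rot : Π x : M, TangentSpace (𝓡 4) x →L[ℝ] ℝ, Horizon.IsRotationalForm cov S l rot ∧
        ∀ (U : Set M) (n : Π x : M, TangentSpace (𝓡 4) x)
          (m : Π x : M, Horizon.CVec (TangentSpace (𝓡 4) x)),
          IsOpen U → Horizon.IsAdaptedTetrad g cov S l v U n m →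
            ∀ p ∈ S ∩ U, ∀ Y : TangentSpace (𝓡 4) p,
              (rot p Y : ℂ) = Horizon.tetradForm g cov S l n m p Y :=
  ⟨Horizon.exists_isRotationalForm hcov hS hl, fun v hv ↦
    ⟨Horizon.rotForm g cov S l (Horizon.cutNormal g S l v),
      Horizon.isRotationalForm_rotForm hcov hS hl
        (Horizon.smoothVecOn_cutNormal (t := t) hS.null hl hv hcov)
        (fun _ hp ↦ Horizon.val_cutNormal_left hv hS.null hl hp),
      fun _ _ _ hU h _ hp Y ↦ Horizon.rotForm_eq_tetradForm hcov hS hl hv hU h hp Y⟩⟩
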